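/- For integers $a,b\ge 0$, write $G\sim\operatorname{Gaussian}(a,b)$ if the entries of the $a\times b$ random matrix $G$ are independent standard normal random variables. Let $\|\cdot\|_{\mathsf F}$ be the Frobenius norm and $A^\dagger$ the Moore--Penrose pseudoinverse. Let $\operatorname{orth}(Y)$ be a matrix with $\operatorname{rank}(Y)$ columns that form an orthonormal basis of the column space of $Y$, and let $[\![A]\!]_k$ be a rank-$k$ truncated singular value decomposition of $A$, i.e. a singular value decomposition of $A$ in which all but the $k$ largest singular values are replaced by $0$. Where $\operatorname{orth}$ and $[\![\cdot]\!]_k$ are not unique, any choice is allowed for which the error below is a random variable. Let $B\in\mathbb R^{m_1\times m_2}$, $M\in\mathbb R^{m_1\times p}$ and $N\in\mathbb R^{q\times m_2}$ be fixed matrices, let $k,s_R,s_L$ be nonnegative integers, and let $\Omega\sim\operatorname{Gaussian}(m_2,s_R)$, $\widetilde\Omega\sim\operatorname{Gaussian}(p,s_R)$, $\Psi\sim\operatorname{Gaussian}(m_1,s_L)$ and $\widetilde\Psi\sim\operatorname{Gaussian}(q,s_L)$ be independent. Define $$Q:=\operatorname{orth}(B\Omega+M\widetilde\Omega),\qquad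 X:=(\Psi^{\mathsf T}Q)^\dagger(\Psi^{\mathsf T}B+\widetilde\Psi^{\mathsf T}N).$$ Then, provided $s_R>2k+1$ and $s_L>2s_R+1$, $$\mathbb E\Bigl[\|B-Q[\![X]\!]_k\|_{\mathsf F}^2\Bigr]\le E_1+E_2+2\sqrt{E_1E_2}$$ (in particular, the expectation is finite), where $$E_1:=\Bigl(1+\frac{k}{s_R-k-1}\Bigr)\|B-[\![B]\!]_k\|_{\mathsf F}^2,$$ $$E_2:=\frac{18k}{s_R-k-1}\|M\|_{\mathsf F}^2+\frac{8s_R}{s_L-s_R-1}\|N\|_{\mathsf F}^2+\frac{32s_R}{s_L-s_R-1}\|B-[\![B]\!]_k\|_{\mathsf F}^2 .$$ -/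

import Mathlib

open MeasureTheory ProbabilityTheory
open scoped Matrix Matrix.Norms.Frobenius

/-! ### The Moore-Penrose pseudoinverse of a real matrix -/

/-- `P` is a Moore-Penrose pseudoinverse of `A`: the four Penrose conditions. -/
structure IsMoorePenrose {m n : ℕ} (A : Matrix (Fin m) (Fin n) ℝ)
    (P : Matrix (Fin n) (Fin m) ℝ) : Prop where
  mul_mul_self : A * P * A = A
  mul_mul_inv : P * A * P = P
  symm_left : (A * P)ᵀ = A * P
  symm_right : (P * A)ᵀ = P * A

theorem IsMoorePenrose.unique {m n : ℕ} {A : Matrix (Fin m) (Fin n) ℝ}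
    {P P' : Matrix (Fin n) (Fin m) ℝ} (h : IsMoorePenrose A P) (h' : IsMoorePenrose A P') :
    P = P' := by
  have e1 : A * P = A * P' := by
    calc A * P = (A * P)ᵀ := h.symm_left.symm
      _ = ((A * P') * (A * P))ᵀ := by
          rw [← Matrix.mul_assoc, h'.mul_mul_self]
      _ = (A * P)ᵀ * (A * P')ᵀ := Matrix.transpose_mul _ _
      _ = (A * P) * (A * P') := by rw [h.symm_left, h'.symm_left]
      _ = A * P' := by rw [← Matrix.mul_assoc, h.mul_mul_self]
  have e2 : P * A = P' * A := by
    calc P * A = (P * A)ᵀ := h.symm_right.symm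
      _ = ((P * A) * (P' * A))ᵀ := by
          rw [Matrix.mul_assoc P A (P' * A), ← Matrix.mul_assoc A P' A, h'.mul_mul_self]
      _ = (P' * A)ᵀ * (P * A)ᵀ := Matrix.transpose_mul _ _
      _ = (P' * A) * (P * A) := by rw [h.symm_right, h'.symm_right]
      _ = P' * A := by
          rw [Matrix.mul_assoc P' A (P * A), ← Matrix.mul_assoc A P A, h.mul_mul_self]
  calc P = P * A * P := h.mul_mul_inv.symm
    _ = P' * A * P := by rw [e2]
    _ = P' * (A * P) := Matrix.mul_assoc _ _ _
    _ = P' * (A * P') := by rw [e1]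
    _ = P' * A * P' := (Matrix.mul_assoc _ _ _).symm
    _ = P' := h'.mul_mul_inv

theorem IsMoorePenrose.exists {m n : ℕ} (A : Matrix (Fin m) (Fin n) ℝ) :
    ∃ P, IsMoorePenrose A P := by
  classical
  have hS : (Aᵀ * A).IsHermitian := by
    simp [Matrix.IsHermitian, Matrix.conjTranspose_eq_transpose_of_trivial, Matrix.transpose_mul]
  obtain ⟨U, d, hU1, hdec⟩ : ∃ (U : Matrix (Fin n) (Fin n) ℝ) (d : Fin n → ℝ),
      Uᵀ * U = 1 ∧ Aᵀ * A = U * Matrix.diagonal d * Uᵀ := by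
    refine ⟨hS.eigenvectorUnitary, hS.eigenvalues, ?_, ?_⟩
    · have := Unitary.coe_star_mul_self hS.eigenvectorUnitary
      simpa [Matrix.star_eq_conjTranspose, Matrix.conjTranspose_eq_transpose_of_trivial] using this
    · have := hS.spectral_theorem
      simpa [Unitary.conjStarAlgAut_apply, Matrix.star_eq_conjTranspose,
        Matrix.conjTranspose_eq_transpose_of_trivial, Function.comp_def] using this
  set S : Matrix (Fin n) (Fin n) ℝ := U * Matrix.diagonal (fun i => (d i)⁻¹) * Uᵀ with hSdef
  have cancel : ∀ X Y : Matrix (Fin n) (Fin n) ℝ,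
      (U * X * Uᵀ) * (U * Y * Uᵀ) = U * (X * Y) * Uᵀ := by
    intro X Y
    calc (U * X * Uᵀ) * (U * Y * Uᵀ) = U * X * (Uᵀ * U) * (Y * Uᵀ) := by
          simp only [Matrix.mul_assoc]
      _ = U * (X * Y) * Uᵀ := by rw [hU1]; simp only [Matrix.mul_assoc, Matrix.mul_one]
  have hST : Sᵀ = S := by
    simp [hSdef, Matrix.transpose_mul, Matrix.mul_assoc]
  have h1 : (Aᵀ * A) * S * (Aᵀ * A) = Aᵀ * A := by
    rw [hdec, hSdef, cancel, cancel, Matrix.diagonal_mul_diagonal, Matrix.diagonal_mul_diagonal]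
    congr 3
    funext i
    by_cases h : d i = 0 <;> simp [h]
  have h2 : S * (Aᵀ * A) * S = S := by
    rw [hdec, hSdef, cancel, cancel, Matrix.diagonal_mul_diagonal, Matrix.diagonal_mul_diagonal]
    congr 3
    funext i
    by_cases h : d i = 0 <;> simp [h]
  have h3 : S * (Aᵀ * A) = (Aᵀ * A) * S := by
    rw [hdec, hSdef, cancel, cancel, Matrix.diagonal_mul_diagonal, Matrix.diagonal_mul_diagonal]
    congr 3
    funext i
    exact mul_comm _ _
  have h4 : A * (S * (Aᵀ * A) - 1) = 0 := by
    have := (Matrix.conjTranspose_mul_self_mul_eq_zero A (S * (Aᵀ * A) - 1)).1 (by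
      rw [Matrix.conjTranspose_eq_transpose_of_trivial, Matrix.mul_sub, ← Matrix.mul_assoc, h1,
        Matrix.mul_one, sub_self])
    exact this
  refine ⟨S * Aᵀ, ?_, ?_, ?_, ?_⟩
  · rw [Matrix.mul_sub, Matrix.mul_one, sub_eq_zero] at h4
    simpa only [Matrix.mul_assoc] using h4
  · calc S * Aᵀ * A * (S * Aᵀ) = (S * (Aᵀ * A) * S) * Aᵀ := by simp only [Matrix.mul_assoc]
      _ = S * Aᵀ := by rw [h2]
  · simp only [Matrix.transpose_mul, Matrix.transpose_transpose, hST, Matrix.mul_assoc]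
  · rw [Matrix.mul_assoc, Matrix.transpose_mul, hST, Matrix.transpose_mul,
      Matrix.transpose_transpose, h3]

/-- The Moore-Penrose pseudoinverse `A†`. -/
noncomputable def pinv {m n : ℕ} (A : Matrix (Fin m) (Fin n) ℝ) : Matrix (Fin n) (Fin m) ℝ :=
  (IsMoorePenrose.exists A).choose

theorem pinv_spec {m n : ℕ} (A : Matrix (Fin m) (Fin n) ℝ) : IsMoorePenrose A (pinv A) :=
  (IsMoorePenrose.exists A).choose_spec

/-! ### Orthonormal bases of column spaces and truncated singular value decompositions -/

/-- `Q = orth(Y)`: the columns of `Q` form an orthonormal basis of the column space of `Y`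
(so `Q` has `rank Y` columns). -/
structure IsOrth {m s : ℕ} (Y : Matrix (Fin m) (Fin s) ℝ)
    (Q : Matrix (Fin m) (Fin Y.rank) ℝ) : Prop where
  orthonormal : Qᵀ * Q = 1
  range_eq : LinearMap.range Q.mulVecLin = LinearMap.range Y.mulVecLin

/-- `T` is a rank-`k` truncated singular value decomposition `⟦A⟧ₖ` of `A`: there is a (thin)
singular value decomposition `A = U Σ Vᵀ`, with the singular values in decreasing order, such that
`T` is obtained from it by keeping the `k` leading singular values and replacing the others by `0`.
(If singular values of `A` are tied, then `T` need not be unique.) -/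
def IsTruncatedSVD {m n : ℕ} (k : ℕ) (A T : Matrix (Fin m) (Fin n) ℝ) : Prop :=
  ∃ (U : Matrix (Fin m) (Fin (min m n)) ℝ) (σ : Fin (min m n) → ℝ)
    (V : Matrix (Fin n) (Fin (min m n)) ℝ),
    Uᵀ * U = 1 ∧ Vᵀ * V = 1 ∧ Antitone σ ∧ (∀ i, 0 ≤ σ i) ∧
    A = U * Matrix.diagonal σ * Vᵀ ∧
    T = U * Matrix.diagonal (fun i => if i.val < k then σ i else 0) * Vᵀ

/-! ### Gaussian random matrices -/

/-- `G ∼ Gaussian(p, q)`: the entries of the `p × q` random matrix `G` are independent standard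
normal random variables. -/
structure IsGaussianMatrix {S : Type*} [MeasurableSpace S] (μ : Measure S) {p q : ℕ}
    (G : S → Matrix (Fin p) (Fin q) ℝ) : Prop where
  hasLaw : ∀ i j, HasLaw (fun ω => G ω i j) (gaussianReal 0 1) μ
  indep : iIndepFun (fun (ij : Fin p × Fin q) ω => G ω ij.1 ij.2) μ

/-- The σ-algebra on the sample space generated by (the entries of) a random matrix. -/
abbrev sigmaOf {S : Type*} {p q : ℕ} (G : S → Matrix (Fin p) (Fin q) ℝ) : MeasurableSpace S :=
  MeasurableSpace.comap (fun ω (i : Fin p) (j : Fin q) => G ω i j) MeasurableSpace.pi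

/-!
Let `Y = B Ω + M Ω'` be the range sketch, `Π = Y Y† = Q Qᵀ` the orthogonal projection onto its
column space, `V` the matrix of the leading right singular vectors of `B`, and `F = Vᵀ Ω`.

*The competitor.* Almost surely `F F† = 1`, and then `Y F† Vᵀ` has rank at most `k` and columns in
the column space of `Y`. Its error is at most `a + c`, where `a = ‖B - B Ω F† Vᵀ‖` satisfies
`a² = ‖B - Bₖ‖² + ‖(B - Bₖ) Ω F†‖²` and `c = ‖M Ω' F†‖` (`norm_sub_noisy_competitor_le`).

*The truncation.* By Eckart-Young (`IsTruncatedSVD.norm_sub_le`) and Pythagoras, the truncation of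
the perturbation `X` of `Qᵀ B` is worse than any such competitor by at most `2 ‖X - Qᵀ B‖`
(`IsTruncatedSVD.norm_sub_orthonormal_mul_le`). As almost surely `(Ψᵀ Q)† Ψᵀ Q = 1`, the norm
`z = ‖X - Qᵀ B‖` is that of `(Ψᵀ Q)† (Ψᵀ (B - Π B) + Ψ'ᵀ N)`. Hence the total error is at most
`a + b` with `b = c + 2 z`.

*The expectations.* All three of them reduce to one estimate, `lintegral_norm_mul_pinv_sq_le`: if
`W` has `r` orthonormal columns and `C W = 0`, then a standard normal `G` with `s` columns satisfies
`𝔼 ‖C G (Wᵀ G)†‖² ≤ ‖C‖² r / (s - r - 1)`. This follows from rotation invariance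
(`map_mulVec_stdNormal`) and from `𝔼 ‖G†‖² ≤ r / (s - r - 1)` for a standard normal `r × s` matrix
`G`. For the latter, the `j`-th column of `G†` has norm `1 / δⱼ`, where `δⱼ` is the distance of the
`j`-th row of `G` to the span of the other rows; conditionally on these, `δⱼ²` is chi-squared with
at least `s - r + 1` degrees of freedom, and `𝔼 (1 / χ²_d) = 1 / (d - 2)`. With
`‖B - Π B‖ ≤ a + c` this gives `𝔼 a² ≤ E₁` and `𝔼 b² ≤ E₂`, and the triangle inequality in `L²`
concludes.

The bases `Q` and the truncations need not depend measurably on the sample point. Therefore `z` is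
written in terms of `Π` (`coreError`), which is a measurable function of `Y` because the
pseudoinverse is measurable (`measurable_pinv`), and expectations are `lintegral`s, for which
`lintegral_prod_le` bounds an integral over a product by an iterated integral.
-/

/-! ### Frobenius norms -/

theorem frobenius_norm_sq {m n : Type*} [Fintype m] [Fintype n] (A : Matrix m n ℝ) :
    ‖A‖ ^ 2 = ∑ i, ∑ j, A i j ^ 2 := by
  have h : 0 ≤ ∑ i, ∑ j, A i j ^ 2 := by positivity
  rw [Matrix.frobenius_norm_def, ← Real.sqrt_eq_rpow]
  simp only [Real.norm_eq_abs, Real.rpow_two, sq_abs]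
  exact Real.sq_sqrt h

theorem frobenius_norm_sq_eq_trace {m n : Type*} [Fintype m] [Fintype n] (A : Matrix m n ℝ) :
    ‖A‖ ^ 2 = (Aᵀ * A).trace := by
  rw [frobenius_norm_sq, Finset.sum_comm]
  simp [Matrix.trace, Matrix.mul_apply, sq]

theorem frobenius_norm_sq_eq_trace' {m n : Type*} [Fintype m] [Fintype n] (A : Matrix m n ℝ) :
    ‖A‖ ^ 2 = (A * Aᵀ).trace := by
  rw [Matrix.trace_mul_comm, frobenius_norm_sq_eq_trace]

theorem frobenius_norm_sq_fromCols {m n₁ n₂ : Type*} [Fintype m] [Fintype n₁] [Fintype n₂]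
    (A : Matrix m n₁ ℝ) (B : Matrix m n₂ ℝ) :
    ‖Matrix.fromCols A B‖ ^ 2 = ‖A‖ ^ 2 + ‖B‖ ^ 2 := by
  simp [frobenius_norm_sq, Finset.sum_add_distrib]

/-- Pythagoras for the Frobenius inner product. -/
theorem frobenius_norm_sq_add {m n : Type*} [Fintype m] [Fintype n] {A B : Matrix m n ℝ}
    (h : (Aᵀ * B).trace = 0) : ‖A + B‖ ^ 2 = ‖A‖ ^ 2 + ‖B‖ ^ 2 := by
  have h' : (Bᵀ * A).trace = 0 := by
    rw [← Matrix.trace_transpose, Matrix.transpose_mul, Matrix.transpose_transpose, h]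
  simp only [frobenius_norm_sq_eq_trace, Matrix.transpose_add, Matrix.add_mul, Matrix.mul_add,
    Matrix.trace_add, h, h']
  ring

/-- The Frobenius norm is invariant under multiplication by a matrix with orthonormal columns. -/
theorem frobenius_norm_orthonormal_mul {m n r : Type*} [Fintype m] [Fintype n] [Fintype r]
    [DecidableEq r] {Q : Matrix m r ℝ} (hQ : Qᵀ * Q = 1) (A : Matrix r n ℝ) :
    ‖Q * A‖ = ‖A‖ := by
  have : ‖Q * A‖ ^ 2 = ‖A‖ ^ 2 := by
    rw [frobenius_norm_sq_eq_trace, frobenius_norm_sq_eq_trace, Matrix.transpose_mul,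
      Matrix.mul_assoc, ← Matrix.mul_assoc Qᵀ, hQ, Matrix.one_mul]
  exact (sq_eq_sq₀ (norm_nonneg _) (norm_nonneg _)).1 this

theorem frobenius_norm_mul_orthonormal_transpose {m n r : Type*} [Fintype m] [Fintype n]
    [Fintype r] [DecidableEq r] {Q : Matrix n r ℝ} (hQ : Qᵀ * Q = 1) (A : Matrix m r ℝ) :
    ‖A * Qᵀ‖ = ‖A‖ := by
  rw [← Matrix.frobenius_norm_transpose, Matrix.transpose_mul, Matrix.transpose_transpose,
    frobenius_norm_orthonormal_mul hQ, Matrix.frobenius_norm_transpose]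

/-! ### Measurability of matrix operations -/

/-- The product σ-algebra on matrices, which is also the Borel σ-algebra. -/
instance Matrix.measurableSpaceReal {m n : Type*} : MeasurableSpace (Matrix m n ℝ) :=
  inferInstanceAs (MeasurableSpace (m → n → ℝ))

instance Matrix.borelSpaceReal {m n : Type*} [Countable m] [Countable n] :
    BorelSpace (Matrix m n ℝ) :=
  inferInstanceAs (BorelSpace (m → n → ℝ))

theorem Matrix.measurable_of_entries {α m n : Type*} [MeasurableSpace α] {f : α → Matrix m n ℝ}
    (h : ∀ i j, Measurable fun x => f x i j) : Measurable f :=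
  measurable_pi_lambda _ fun i => measurable_pi_lambda _ fun j => h i j

theorem Measurable.matrix_entry {α m n : Type*} [MeasurableSpace α] {f : α → Matrix m n ℝ}
    (hf : Measurable f) (i : m) (j : n) : Measurable fun x => f x i j :=
  (measurable_pi_apply j).comp ((measurable_pi_apply i).comp hf)

@[fun_prop]
theorem Measurable.matrix_mul {α l m n : Type*} [Fintype m] [MeasurableSpace α]
    {f : α → Matrix l m ℝ} {g : α → Matrix m n ℝ} (hf : Measurable f) (hg : Measurable g) :
    Measurable fun x => f x * g x := by
  refine Matrix.measurable_of_entries fun i j => ?_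
  simp only [Matrix.mul_apply]
  exact Finset.measurable_sum _ fun k _ => (hf.matrix_entry i k).mul (hg.matrix_entry k j)

@[fun_prop]
theorem Measurable.matrix_transpose {α m n : Type*} [MeasurableSpace α]
    {f : α → Matrix m n ℝ} (hf : Measurable f) : Measurable fun x => (f x)ᵀ := by
  refine Matrix.measurable_of_entries fun i j => ?_
  exact hf.matrix_entry j i

@[fun_prop]
theorem Measurable.matrix_add {α m n : Type*} [MeasurableSpace α]
    {f g : α → Matrix m n ℝ} (hf : Measurable f) (hg : Measurable g) :
    Measurable fun x => f x + g x := by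
  refine Matrix.measurable_of_entries fun i j => ?_
  exact (hf.matrix_entry i j).add (hg.matrix_entry i j)

@[fun_prop]
theorem Measurable.matrix_sub {α m n : Type*} [MeasurableSpace α]
    {f g : α → Matrix m n ℝ} (hf : Measurable f) (hg : Measurable g) :
    Measurable fun x => f x - g x := by
  refine Matrix.measurable_of_entries fun i j => ?_
  exact (hf.matrix_entry i j).sub (hg.matrix_entry i j)

@[fun_prop]
theorem Measurable.frobenius_norm {α m n : Type*} [Fintype m] [Fintype n] [MeasurableSpace α]
    {f : α → Matrix m n ℝ} (hf : Measurable f) : Measurable fun x => ‖f x‖ := by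
  have : (fun x => ‖f x‖) = fun x => √(∑ i, ∑ j, f x i j ^ 2) := by
    funext x
    rw [← frobenius_norm_sq, Real.sqrt_sq (norm_nonneg _)]
  rw [this]
  exact (Finset.measurable_sum _ fun i _ =>
    Finset.measurable_sum _ fun j _ => (hf.matrix_entry i j).pow_const 2).sqrt

theorem isClosed_setOf_isMoorePenrose (m n : ℕ) :
    IsClosed {p : Matrix (Fin m) (Fin n) ℝ × Matrix (Fin n) (Fin m) ℝ |
      IsMoorePenrose p.1 p.2} := by
  have : {p : Matrix (Fin m) (Fin n) ℝ × Matrix (Fin n) (Fin m) ℝ | IsMoorePenrose p.1 p.2} =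
      {p | p.1 * p.2 * p.1 = p.1} ∩ {p | p.2 * p.1 * p.2 = p.2} ∩
        {p | (p.1 * p.2)ᵀ = p.1 * p.2} ∩ {p | (p.2 * p.1)ᵀ = p.2 * p.1} := by
    ext p
    exact ⟨fun h => ⟨⟨⟨h.1, h.2⟩, h.3⟩, h.4⟩, fun h => ⟨h.1.1.1, h.1.1.2, h.1.2, h.2⟩⟩
  rw [this]
  refine ((IsClosed.inter ?_ ?_).inter ?_).inter ?_ <;> refine isClosed_eq ?_ ?_ <;> fun_prop

/-- The pseudoinverse is discontinuous, but its graph is closed; as the target is a countable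
union of compact sets, the preimage of a closed set is a countable union of closed sets. -/
theorem measurable_pinv (m n : ℕ) :
    Measurable (pinv : Matrix (Fin m) (Fin n) ℝ → Matrix (Fin n) (Fin m) ℝ) := by
  refine measurable_of_isClosed fun C hC => ?_
  have hcl : ∀ K : Set (Matrix (Fin n) (Fin m) ℝ), IsCompact K →
      IsClosed {A : Matrix (Fin m) (Fin n) ℝ | ∃ P ∈ K, IsMoorePenrose A P} := by
    intro K hK
    have : CompactSpace K := isCompact_iff_compactSpace.1 hK
    have hmap : IsClosedMap (Prod.fst : Matrix (Fin m) (Fin n) ℝ × K → _) :=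
      isClosedMap_fst_of_compactSpace
    have hpre : IsClosed {p : Matrix (Fin m) (Fin n) ℝ × K | IsMoorePenrose p.1 (p.2 : _)} :=
      (isClosed_setOf_isMoorePenrose m n).preimage
        (f := fun p : Matrix (Fin m) (Fin n) ℝ × K => (p.1, (p.2 : Matrix (Fin n) (Fin m) ℝ)))
        (by fun_prop)
    convert hmap _ hpre using 1
    ext A
    constructor
    · rintro ⟨P, hP, h⟩
      exact ⟨(A, ⟨P, hP⟩), h, rfl⟩
    · rintro ⟨⟨A', P⟩, h, rfl⟩
      exact ⟨P, P.2, h⟩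
  have : ProperSpace (Matrix (Fin n) (Fin m) ℝ) := FiniteDimensional.proper_real _
  have heq : pinv ⁻¹' C = ⋃ N : ℕ,
      {A : Matrix (Fin m) (Fin n) ℝ | ∃ P ∈ Metric.closedBall 0 (N : ℝ) ∩ C,
        IsMoorePenrose A P} := by
    ext A
    simp only [Set.mem_preimage, Set.mem_iUnion, Set.mem_ofPred_eq]
    constructor
    · intro hA
      obtain ⟨N, hN⟩ := exists_nat_ge ‖pinv A‖
      exact ⟨N, pinv A, ⟨by simpa using hN, hA⟩, pinv_spec A⟩
    · rintro ⟨N, P, ⟨-, hP⟩, h⟩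
      rwa [(pinv_spec A).unique h]
  rw [heq]
  exact MeasurableSet.iUnion fun N =>
    (hcl _ ((isCompact_closedBall _ _).inter_right hC)).measurableSet

@[fun_prop]
theorem Measurable.matrix_pinv {α : Type*} {m n : ℕ} [MeasurableSpace α]
    {f : α → Matrix (Fin m) (Fin n) ℝ} (hf : Measurable f) : Measurable fun x => pinv (f x) :=
  (measurable_pinv m n).comp hf

/-! ### Standard normal vectors and matrices -/

/-- The law of a vector of independent standard normal random variables indexed by `ι`. A random
matrix with independent standard normal entries is encoded by the index type `m × n`, see
`matOf`. -/
noncomputable abbrev stdNormal (ι : Type*) [Fintype ι] : Measure (ι → ℝ) :=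
  Measure.pi fun _ => gaussianReal 0 1

/-- The matrix with entries `x (i, j)`. -/
def matOf {m n : Type*} (x : m × n → ℝ) : Matrix m n ℝ := Matrix.of fun i j => x (i, j)

@[fun_prop]
theorem measurable_matOf {m n : Type*} : Measurable (matOf : (m × n → ℝ) → Matrix m n ℝ) :=
  Matrix.measurable_of_entries fun i j => measurable_pi_apply (i, j)

/-- The standard normal law is invariant under linear maps with orthonormal rows. -/
theorem map_mulVec_stdNormal {ι κ : Type*} [Fintype ι] [Fintype κ] [DecidableEq κ]
    {A : Matrix κ ι ℝ} (hA : A * Aᵀ = 1) :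
    (stdNormal ι).map (fun x => A *ᵥ x) = stdNormal κ := by
  have hAm : Measurable (fun x : ι → ℝ => A *ᵥ x) := by
    have : Continuous (fun x : ι → ℝ => A *ᵥ x) := by fun_prop
    exact this.measurable
  have key : ((stdNormal ι).map (fun x => A *ᵥ x)).map (WithLp.toLp 2) =
      (stdNormal κ).map (WithLp.toLp 2) := by
    rw [map_pi_eq_stdGaussian]
    apply Measure.ext_of_charFun
    funext t
    have h1 := congrFun (congrArg charFun (map_pi_eq_stdGaussian (ι := ι)))
      (WithLp.toLp 2 (Aᵀ *ᵥ t.ofLp))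
    rw [charFun_stdGaussian] at h1 ⊢
    have hn : ‖(WithLp.toLp 2 (Aᵀ *ᵥ t.ofLp) : EuclideanSpace ℝ ι)‖ ^ 2 = ‖t‖ ^ 2 := by
      rw [← real_inner_self_eq_norm_sq, ← real_inner_self_eq_norm_sq,
        EuclideanSpace.inner_eq_star_dotProduct, EuclideanSpace.inner_eq_star_dotProduct]
      simp only [star_trivial]
      rw [Matrix.mulVec_transpose, ← Matrix.dotProduct_mulVec, ← Matrix.mulVec_transpose,
        Matrix.mulVec_mulVec, hA, Matrix.one_mulVec]
    rw [← Complex.ofReal_pow, hn, Complex.ofReal_pow] at h1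
    rw [← h1, charFun_apply, charFun_apply, Measure.map_map (by fun_prop) hAm,
      integral_map (by fun_prop) (by fun_prop), integral_map (by fun_prop) (by fun_prop)]
    congr 1
    funext x
    simp only [Function.comp_apply, EuclideanSpace.inner_eq_star_dotProduct, star_trivial]
    rw [Matrix.mulVec_transpose, ← Matrix.dotProduct_mulVec]
  have h2 := congrArg (Measure.map (WithLp.ofLp : EuclideanSpace ℝ κ → κ → ℝ)) key
  rw [Measure.map_map (by fun_prop) (by fun_prop)] at h2
  exact Measure.map_id.symm.trans (h2.trans
    ((Measure.map_map (by fun_prop) (by fun_prop)).trans Measure.map_id))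

/-- Invariance for the block matrix `[A A']`, with the vector split into its two blocks. -/
theorem map_mulVec_add_mulVec_stdNormal {ι ι' κ : Type*} [Fintype ι] [Fintype ι'] [Fintype κ]
    [DecidableEq κ] {A : Matrix κ ι ℝ} {A' : Matrix κ ι' ℝ} (hA : A * Aᵀ + A' * A'ᵀ = 1) :
    ((stdNormal ι).prod (stdNormal ι')).map (fun x => A *ᵥ x.1 + A' *ᵥ x.2) = stdNormal κ := by
  have h1 := (measurePreserving_sumPiEquivProdPi
    (fun _ : ι ⊕ ι' => gaussianReal 0 1)).map_eq
  rw [← h1, Measure.map_map]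
  · have := map_mulVec_stdNormal (A := Matrix.fromCols A A') (by
      rw [Matrix.transpose_fromCols, Matrix.fromCols_mul_fromRows, hA])
    rw [← this]
    congr 1
    funext x
    rw [Matrix.fromCols_mulVec]
    rfl
  · have : Continuous (fun x : (ι → ℝ) × (ι' → ℝ) => A *ᵥ x.1 + A' *ᵥ x.2) := by fun_prop
    exact this.measurable
  · exact MeasurableEquiv.measurable _

open scoped Kronecker in
theorem kronecker_one_mulVec {ι κ σ : Type*} [Fintype ι] [Fintype σ] [DecidableEq σ]
    (A : Matrix κ ι ℝ) (x : ι × σ → ℝ) (p : κ × σ) :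
    ((A ⊗ₖ (1 : Matrix σ σ ℝ)) *ᵥ x) p = (A * matOf x) p.1 p.2 := by
  simp [Matrix.mulVec, dotProduct, Matrix.mul_apply, matOf, Fintype.sum_prod_type,
    Matrix.one_apply]

/-- Left multiplication by a matrix with orthonormal rows preserves standard normal matrices. -/
theorem lintegral_mul_stdNormal {ι κ σ : Type*} [Fintype ι] [Fintype κ] [Fintype σ]
    [DecidableEq κ] {A : Matrix κ ι ℝ} (hA : A * Aᵀ = 1)
    {f : Matrix κ σ ℝ → ENNReal} (hf : Measurable f) :
    ∫⁻ x, f (A * matOf x) ∂stdNormal (ι × σ) = ∫⁻ y, f (matOf y) ∂stdNormal (κ × σ) := by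
  classical
  have h := map_mulVec_stdNormal (A := Matrix.kroneckerMap (· * ·) A (1 : Matrix σ σ ℝ)) (by
    rw [← Matrix.kroneckerMap_transpose, ← Matrix.mul_kronecker_mul, hA, Matrix.transpose_one,
      Matrix.one_mul, Matrix.one_kronecker_one])
  rw [← h, lintegral_map (by fun_prop)]
  · congr 1 with x
    congr 1
    ext i j
    exact (kronecker_one_mulVec A x (i, j)).symm
  · refine Continuous.measurable ?_
    fun_prop

theorem lintegral_mul_add_mul_stdNormal {ι ι' κ σ : Type*} [Fintype ι] [Fintype ι'] [Fintype κ]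
    [Fintype σ] [DecidableEq κ] {A : Matrix κ ι ℝ} {A' : Matrix κ ι' ℝ}
    (hA : A * Aᵀ + A' * A'ᵀ = 1) {f : Matrix κ σ ℝ → ENNReal} (hf : Measurable f) :
    ∫⁻ x, f (A * matOf x.1 + A' * matOf x.2) ∂(stdNormal (ι × σ)).prod (stdNormal (ι' × σ)) =
      ∫⁻ y, f (matOf y) ∂stdNormal (κ × σ) := by
  classical
  have h := map_mulVec_add_mulVec_stdNormal
    (A := Matrix.kroneckerMap (· * ·) A (1 : Matrix σ σ ℝ))
    (A' := Matrix.kroneckerMap (· * ·) A' (1 : Matrix σ σ ℝ)) (by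
    rw [← Matrix.kroneckerMap_transpose, ← Matrix.mul_kronecker_mul,
      ← Matrix.kroneckerMap_transpose, ← Matrix.mul_kronecker_mul, Matrix.transpose_one,
      Matrix.one_mul, ← Matrix.add_kronecker, hA, Matrix.one_kronecker_one])
  rw [← h, lintegral_map (by fun_prop)]
  · congr 1 with x
    congr 1
    ext i j
    exact congrArg₂ (· + ·) (kronecker_one_mulVec A x.1 (i, j)).symm
      (kronecker_one_mulVec A' x.2 (i, j)).symm
  · refine Continuous.measurable ?_
    fun_prop

theorem map_curry_stdNormal (ι κ : Type*) [Fintype ι] [Fintype κ] :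
    (stdNormal (ι × κ)).map (fun x i j => x (i, j)) = Measure.pi fun _ : ι => stdNormal κ := by
  have h : stdNormal (ι × κ) =
      (Measure.pi fun _ : ι => stdNormal κ).map (fun y p => y p.1 p.2) := by
    refine Measure.pi_eq fun s hs => ?_
    rw [Measure.map_apply (by fun_prop) (MeasurableSet.univ_pi hs)]
    have : (fun (y : ι → κ → ℝ) (p : ι × κ) => y p.1 p.2) ⁻¹' Set.univ.pi s =
        Set.univ.pi fun i => Set.univ.pi fun j => s (i, j) := by
      ext y
      simp [Set.mem_pi]
    rw [this, Measure.pi_pi, Fintype.prod_prod_type]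
    simp only [Measure.pi_pi]
  rw [h, Measure.map_map (by fun_prop) (by fun_prop)]
  exact Measure.map_id

/-! ### The mean of the inverse of a chi-squared random variable -/

theorem lintegral_exp_neg_mul_sq_gaussianReal {t : ℝ} (ht : 0 ≤ t) :
    ∫⁻ x, ENNReal.ofReal (Real.exp (-(t * x ^ 2 / 2))) ∂gaussianReal 0 1 =
      ENNReal.ofReal ((1 + t) ^ (-(1 / 2) : ℝ)) := by
  have h1 : 0 < 1 + t := by linarith
  have hπ := Real.pi_pos
  rw [gaussianReal_of_var_ne_zero 0 one_ne_zero,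
    lintegral_withDensity_eq_lintegral_mul _ (by fun_prop) (by fun_prop)]
  have hpt : ∀ x : ℝ, (gaussianPDF 0 1 * fun x => ENNReal.ofReal (Real.exp (-(t * x ^ 2 / 2)))) x
      = ENNReal.ofReal ((√(2 * Real.pi))⁻¹ * Real.exp (-((1 + t) / 2) * x ^ 2)) := by
    intro x
    simp only [Pi.mul_apply, gaussianPDF, gaussianPDFReal]
    rw [← ENNReal.ofReal_mul (by positivity), mul_assoc, ← Real.exp_add]
    congr 2
    · simp
    · congr 1
      simp
      ring
  simp_rw [hpt]
  rw [← ofReal_integral_eq_lintegral_ofReal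
    ((integrable_exp_neg_mul_sq (by positivity)).const_mul _)
    (ae_of_all _ fun x => by positivity), integral_const_mul, integral_gaussian]
  congr 1
  rw [show Real.pi / ((1 + t) / 2) = 2 * Real.pi / (1 + t) by field_simp,
    Real.sqrt_div (by positivity), Real.rpow_neg h1.le, ← Real.sqrt_eq_rpow]
  field_simp

theorem lintegral_exp_neg_mul_sum_sq_stdNormal (ι : Type*) [Fintype ι] {t : ℝ} (ht : 0 ≤ t) :
    ∫⁻ x, ENNReal.ofReal (Real.exp (-(t * (∑ i, x i ^ 2) / 2))) ∂stdNormal ι =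
      ENNReal.ofReal ((1 + t) ^ (-(Fintype.card ι / 2) : ℝ)) := by
  have h1 : 0 < 1 + t := by linarith
  have hpt : ∀ x : ι → ℝ, ENNReal.ofReal (Real.exp (-(t * (∑ i, x i ^ 2) / 2))) =
      ∏ i, ENNReal.ofReal (Real.exp (-(t * x i ^ 2 / 2))) := by
    intro x
    rw [← ENNReal.ofReal_prod_of_nonneg (fun i _ => (Real.exp_pos _).le), ← Real.exp_sum,
      Finset.sum_neg_distrib, Finset.mul_sum, Finset.sum_div]
  simp_rw [hpt]
  have hind := iIndepFun_pi (μ := fun _ : ι => gaussianReal 0 1)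
    (X := fun _ x => ENNReal.ofReal (Real.exp (-(t * x ^ 2 / 2)))) (fun i => by fun_prop)
  rw [lintegral_prod_eq_prod_lintegral_of_indepFun _ _ hind (fun i => by fun_prop)]
  have hev : ∀ i, ∫⁻ x : ι → ℝ, ENNReal.ofReal (Real.exp (-(t * x i ^ 2 / 2))) ∂stdNormal ι =
      ENNReal.ofReal ((1 + t) ^ (-(1 / 2) : ℝ)) := by
    intro i
    rw [← lintegral_exp_neg_mul_sq_gaussianReal ht]
    exact (measurePreserving_eval (fun _ : ι => gaussianReal 0 1) i).lintegral_comp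
      (f := fun y => ENNReal.ofReal (Real.exp (-(t * y ^ 2 / 2)))) (by fun_prop)
  simp_rw [hev]
  rw [Finset.prod_const, ← ENNReal.ofReal_pow (by positivity), ← Real.rpow_natCast,
    ← Real.rpow_mul h1.le]
  congr 2
  simp
  ring

theorem ennreal_inv_le_lintegral_exp {y : ℝ} (hy : 0 ≤ y) :
    (ENNReal.ofReal y)⁻¹ ≤ 2⁻¹ * ∫⁻ t in Set.Ioi (0 : ℝ),
      ENNReal.ofReal (Real.exp (-(t * y / 2))) := by
  -- for `y = 0` both sides are infinite
  rcases hy.eq_or_lt with rfl | hy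
  · simp [ENNReal.mul_top]
  · have hint : ∫ t in Set.Ioi (0 : ℝ), Real.exp (-(t * y / 2)) = 2 / y := by
      have := integral_exp_mul_Ioi (a := -(y / 2)) (by linarith) 0
      simp only [mul_zero, Real.exp_zero] at this
      rw [show (fun t : ℝ => Real.exp (-(t * y / 2))) = fun t => Real.exp (-(y / 2) * t) by
        funext t; congr 1; ring, this]
      field_simp
    have hI : IntegrableOn (fun t : ℝ => Real.exp (-(t * y / 2))) (Set.Ioi 0) := by
      have := integrableOn_exp_mul_Ioi (a := -(y / 2)) (by linarith) 0
      refine this.congr_fun (fun t _ => ?_) measurableSet_Ioi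
      simp only
      congr 1; ring
    rw [← ofReal_integral_eq_lintegral_ofReal hI (ae_of_all _ fun x => (Real.exp_pos _).le), hint,
      ← ENNReal.ofReal_inv_of_pos hy,
      show (2⁻¹ : ENNReal) = ENNReal.ofReal 2⁻¹ by
        rw [ENNReal.ofReal_inv_of_pos (by norm_num)]; simp,
      ← ENNReal.ofReal_mul (by norm_num)]
    apply le_of_eq
    congr 1
    field_simp

/-- `𝔼 (1 / χ²_d) ≤ 1 / (d - 2)` for `d ≥ 3` degrees of freedom, from
`1 / y = ½ ∫₀^∞ exp (- t y / 2) dt` and Tonelli. -/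
theorem lintegral_inv_sum_sq_stdNormal_le {d : ℕ} (hd : 3 ≤ d) :
    ∫⁻ x, (ENNReal.ofReal (∑ i, x i ^ 2))⁻¹ ∂stdNormal (Fin d) ≤
      ENNReal.ofReal (1 / ((d : ℝ) - 2)) := by
  have hd' : (3 : ℝ) ≤ d := by exact_mod_cast hd
  calc ∫⁻ x, (ENNReal.ofReal (∑ i, x i ^ 2))⁻¹ ∂stdNormal (Fin d)
      ≤ ∫⁻ x, (2⁻¹ * ∫⁻ t in Set.Ioi (0 : ℝ),
          ENNReal.ofReal (Real.exp (-(t * (∑ i, x i ^ 2) / 2)))) ∂stdNormal (Fin d) :=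
        lintegral_mono fun x => ennreal_inv_le_lintegral_exp (by positivity)
    _ = 2⁻¹ * ∫⁻ t in Set.Ioi (0 : ℝ), ∫⁻ x,
          ENNReal.ofReal (Real.exp (-(t * (∑ i, x i ^ 2) / 2))) ∂stdNormal (Fin d) := by
        rw [lintegral_const_mul' _ _ (by simp), lintegral_lintegral_swap]
        refine Measurable.aemeasurable ?_
        unfold Function.uncurry
        fun_prop
    _ = 2⁻¹ * ∫⁻ t in Set.Ioi (0 : ℝ), ENNReal.ofReal ((1 + t) ^ (-((d : ℝ) / 2))) := by
        congr 1
        refine setLIntegral_congr_fun measurableSet_Ioi fun t ht => ?_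
        rw [lintegral_exp_neg_mul_sum_sq_stdNormal _ (le_of_lt ht), Fintype.card_fin]
    _ = ENNReal.ofReal (1 / ((d : ℝ) - 2)) := by
        have ha : -((d : ℝ) / 2) < -1 := by linarith
        have hcomp : ∫⁻ t in Set.Ioi (0 : ℝ), ENNReal.ofReal ((1 + t) ^ (-((d : ℝ) / 2))) =
            ∫⁻ t in Set.Ioi (1 : ℝ), ENNReal.ofReal (t ^ (-((d : ℝ) / 2))) := by
          have := (measurePreserving_add_left volume (1 : ℝ)).setLIntegral_comp_preimage_emb
            (measurableEmbedding_addLeft 1) (fun t => ENNReal.ofReal (t ^ (-((d : ℝ) / 2))))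
            (Set.Ioi 1)
          rw [← this]
          simp
        rw [hcomp, ← ofReal_integral_eq_lintegral_ofReal
          ((integrableOn_Ioi_rpow_iff one_pos).2 ha), integral_Ioi_rpow_of_lt ha one_pos,
          show (2⁻¹ : ENNReal) = ENNReal.ofReal 2⁻¹ by
            rw [ENNReal.ofReal_inv_of_pos (by norm_num)]; simp,
          ← ENNReal.ofReal_mul (by norm_num)]
        · congr 1
          rw [Real.one_rpow]
          have h1 : -((d : ℝ) / 2) + 1 ≠ 0 := by linarith
          have h2 : (d : ℝ) - 2 ≠ 0 := by linarith
          rw [inv_mul_eq_div, div_div, neg_div, ← div_neg]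
          congr 1
          ring
        · refine (ae_restrict_iff' measurableSet_Ioi).2 (ae_of_all _ fun t ht => ?_)
          have : (0 : ℝ) < t := lt_trans one_pos ht
          positivity

theorem lintegral_inv_sum_sq_mulVec_stdNormal_le {d : ℕ} (hd : 3 ≤ d) {σ : Type*} [Fintype σ]
    {U : Matrix (Fin d) σ ℝ} (hU : U * Uᵀ = 1) :
    ∫⁻ x, (ENNReal.ofReal (∑ i, (U *ᵥ x) i ^ 2))⁻¹ ∂stdNormal σ ≤
      ENNReal.ofReal (1 / ((d : ℝ) - 2)) := by
  refine le_trans (le_of_eq ?_) (lintegral_inv_sum_sq_stdNormal_le hd)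
  rw [← map_mulVec_stdNormal hU, lintegral_map (by fun_prop)]
  exact Continuous.measurable (by fun_prop)

/-! ### The pseudoinverse of a standard normal matrix -/

/-- `F† eⱼ` is the solution of `F v = eⱼ` of least norm. -/
theorem pinv_col_of_mulVec_eq_single {r s : ℕ} {F : Matrix (Fin r) (Fin s) ℝ} {j : Fin r}
    {v : Fin s → ℝ} (hv : F *ᵥ v = Pi.single j 1) :
    (∀ i, (F * pinv F) i j = (1 : Matrix (Fin r) (Fin r) ℝ) i j) ∧
      ∑ i, pinv F i j ^ 2 ≤ v ⬝ᵥ v := by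
  obtain ⟨h1, h2, -, h4⟩ := pinv_spec F
  constructor
  · intro i
    have : (F * pinv F) *ᵥ Pi.single j 1 = (1 : Matrix (Fin r) (Fin r) ℝ) *ᵥ Pi.single j 1 := by
      rw [← hv, Matrix.mulVec_mulVec, h1, Matrix.one_mulVec]
    simpa using congrFun this i
  · set w := (pinv F * F) *ᵥ v with hw
    have hcol : ∀ i, pinv F i j = w i := by
      intro i
      rw [hw, ← Matrix.mulVec_mulVec, hv]
      simp
    have hPw : (pinv F * F) *ᵥ w = w := by
      rw [hw, Matrix.mulVec_mulVec, ← Matrix.mul_assoc, h2]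
    have hww : w ⬝ᵥ w = v ⬝ᵥ w := by
      calc w ⬝ᵥ w = ((pinv F * F)ᵀ *ᵥ v) ⬝ᵥ w := by rw [h4]
        _ = v ⬝ᵥ w := by rw [Matrix.mulVec_transpose, ← Matrix.dotProduct_mulVec, hPw]
    have hnn : 0 ≤ (v - w) ⬝ᵥ (v - w) := by
      simp only [dotProduct]
      exact Finset.sum_nonneg fun i _ => mul_self_nonneg _
    rw [sub_dotProduct, dotProduct_sub, dotProduct_sub, hww, dotProduct_comm w v] at hnn
    have : ∑ i, pinv F i j ^ 2 = v ⬝ᵥ w := by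
      rw [← hww]
      simp [dotProduct, hcol, sq]
    linarith

/-- The squared norm of the `j`-th column of `F†`, with the value `⊤` if this column does not
solve `F v = eⱼ`, that is, if row `j` of `F` lies in the span of the other rows. -/
noncomputable def pinvColSq {r s : ℕ} (j : Fin r) (F : Matrix (Fin r) (Fin s) ℝ) : ENNReal :=
  open Classical in
  if ∀ i, (F * pinv F) i j = (1 : Matrix (Fin r) (Fin r) ℝ) i j then
    ENNReal.ofReal (∑ i, pinv F i j ^ 2) else ⊤

theorem measurable_pinvColSq {r s : ℕ} (j : Fin r) :
    Measurable (pinvColSq j : Matrix (Fin r) (Fin s) ℝ → ENNReal) := by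
  have h1 := measurable_pinv r s
  have h2 : Measurable fun F : Matrix (Fin r) (Fin s) ℝ => F * pinv F := by fun_prop
  refine Measurable.ite ?_ ?_ measurable_const
  · rw [Set.ofPred_forall]
    exact MeasurableSet.iInter fun i =>
      measurableSet_eq_fun (h2.matrix_entry i j) measurable_const
  · exact (Finset.measurable_sum _ fun i _ => (h1.matrix_entry i j).pow_const 2).ennreal_ofReal

/-- The norm of the `j`-th column of `F†` is the inverse of the distance of row `j` to the span
of the other rows. Here this distance is bounded from below by means of an orthonormal family (the
rows of `U`) that is orthogonal to the other rows. -/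
theorem pinvColSq_le {r s d : ℕ} {F : Matrix (Fin r) (Fin s) ℝ} {j : Fin r}
    {U : Matrix (Fin d) (Fin s) ℝ} (hU : U * Uᵀ = 1) (h0 : ∀ i, i ≠ j → U *ᵥ F.row i = 0) :
    pinvColSq j F ≤ (ENNReal.ofReal (∑ a, (U *ᵥ F.row j) a ^ 2))⁻¹ := by
  set u := U *ᵥ F.row j with hu
  have hy : ∑ a, u a ^ 2 = u ⬝ᵥ u := by simp [dotProduct, sq]
  rw [hy]
  have hnn : 0 ≤ u ⬝ᵥ u := by rw [← hy]; positivity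
  -- if row `j` is orthogonal to the rows of `U`, the right-hand side is `⊤`
  rcases hnn.eq_or_lt with h | hpos
  · simp [← h]
  have hrow : ∀ i, F.row i ⬝ᵥ (Uᵀ *ᵥ u) = (U *ᵥ F.row i) ⬝ᵥ u := by
    intro i
    rw [Matrix.mulVec_transpose, dotProduct_comm, ← Matrix.dotProduct_mulVec, dotProduct_comm]
  have hv : F *ᵥ ((u ⬝ᵥ u)⁻¹ • (Uᵀ *ᵥ u)) = Pi.single j 1 := by
    funext i
    rw [Matrix.mulVec_smul, Pi.smul_apply,
      show (F *ᵥ (Uᵀ *ᵥ u)) i = (U *ᵥ F.row i) ⬝ᵥ u from hrow i]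
    by_cases hij : i = j
    · subst hij
      rw [← hu, Pi.single_eq_same, smul_eq_mul, inv_mul_cancel₀ hpos.ne']
    · rw [h0 i hij, zero_dotProduct, smul_zero, Pi.single_eq_of_ne hij]
  obtain ⟨h1, h2⟩ := pinv_col_of_mulVec_eq_single hv
  rw [pinvColSq, if_pos h1, ← ENNReal.ofReal_inv_of_pos hpos]
  refine ENNReal.ofReal_le_ofReal (h2.trans (le_of_eq ?_))
  have : (Uᵀ *ᵥ u) ⬝ᵥ (Uᵀ *ᵥ u) = u ⬝ᵥ u := by
    rw [Matrix.dotProduct_mulVec, Matrix.vecMul_transpose, Matrix.mulVec_mulVec, hU,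
      Matrix.one_mulVec]
  rw [smul_dotProduct, dotProduct_smul, this]
  simp only [smul_eq_mul]
  field_simp

/-- The orthogonal complement of `r - 1` vectors in `ℝˢ` has dimension at least `s - r + 1`. -/
theorem exists_orthonormal_rows_orthogonal {r s : ℕ}
    (F : Matrix (Fin r) (Fin s) ℝ) (j : Fin r) :
    ∃ d, s + 1 ≤ d + r ∧ ∃ U : Matrix (Fin d) (Fin s) ℝ, U * Uᵀ = 1 ∧
      ∀ i, i ≠ j → U *ᵥ F.row i = 0 := by
  classical
  let w : {i // i ≠ j} → EuclideanSpace ℝ (Fin s) := fun i => WithLp.toLp 2 (F.row i)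
  let K := (Submodule.span ℝ (Set.range w))ᗮ
  have hdim : Module.finrank ℝ (Submodule.span ℝ (Set.range w)) + Module.finrank ℝ K = _ :=
    Submodule.finrank_add_finrank_orthogonal (Submodule.span ℝ (Set.range w))
  have hspan := finrank_range_le_card (R := ℝ) w
  rw [Set.finrank] at hspan
  rw [finrank_euclideanSpace, Fintype.card_fin] at hdim
  have hcard : Fintype.card {i // i ≠ j} = r - 1 := by
    simp [Fintype.card_subtype_compl]
  have hr : 0 < r := j.pos
  let b := stdOrthonormalBasis ℝ K
  have hin : ∀ x y : EuclideanSpace ℝ (Fin s), inner ℝ x y = x.ofLp ⬝ᵥ y.ofLp := by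
    intro x y
    rw [EuclideanSpace.inner_eq_star_dotProduct, star_trivial, dotProduct_comm]
  refine ⟨Module.finrank ℝ K, by omega, Matrix.of fun a => (b a : EuclideanSpace ℝ (Fin s)).ofLp,
    ?_, ?_⟩
  · ext a c
    rw [Matrix.mul_apply']
    have h := orthonormal_iff_ite.1 b.orthonormal a c
    rw [Submodule.coe_inner, hin] at h
    rw [Matrix.one_apply, ← h]
    rfl
  · intro i hi
    funext a
    have h : inner ℝ (w ⟨i, hi⟩) (b a : EuclideanSpace ℝ (Fin s)) = 0 :=
      (Submodule.mem_orthogonal _ _).1 (b a).2 _ (Submodule.subset_span ⟨_, rfl⟩)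
    rw [hin, dotProduct_comm] at h
    exact h

theorem lintegral_pinvColSq_le {r s : ℕ} (hrs : r + 2 ≤ s) (j : Fin r) :
    ∫⁻ x, pinvColSq j (matOf x) ∂stdNormal (Fin r × Fin s) ≤
      ENNReal.ofReal (1 / ((s : ℝ) - r - 1)) := by
  classical
  have hm : Measurable fun y : Fin r → Fin s → ℝ => pinvColSq j (Matrix.of y) :=
    (measurable_pinvColSq j).comp measurable_id
  have h1 : ∫⁻ x, pinvColSq j (matOf x) ∂stdNormal (Fin r × Fin s) =
      ∫⁻ y, pinvColSq j (Matrix.of y) ∂(Measure.pi fun _ : Fin r => stdNormal (Fin s)) := by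
    rw [← map_curry_stdNormal, lintegral_map hm (by fun_prop)]
    rfl
  -- integrate over row `j` first, for fixed values of the other rows
  rw [h1, lintegral_eq_lmarginal_univ 0, lmarginal_erase' _ hm (Finset.mem_univ j)]
  have hinner : ∀ y : Fin r → Fin s → ℝ,
      ∫⁻ z, pinvColSq j (Matrix.of (Function.update y j z)) ∂stdNormal (Fin s) ≤
        ENNReal.ofReal (1 / ((s : ℝ) - r - 1)) := by
    intro y
    obtain ⟨d, hd, U, hU, h0⟩ := exists_orthonormal_rows_orthogonal (Matrix.of y) j
    have hd' : (s : ℝ) + 1 ≤ d + r := by exact_mod_cast hd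
    have hrs' : (r : ℝ) + 2 ≤ s := by exact_mod_cast hrs
    calc ∫⁻ z, pinvColSq j (Matrix.of (Function.update y j z)) ∂stdNormal (Fin s)
        ≤ ∫⁻ z, (ENNReal.ofReal (∑ a, (U *ᵥ z) a ^ 2))⁻¹ ∂stdNormal (Fin s) := by
          refine lintegral_mono fun z => ?_
          refine (pinvColSq_le hU fun i hi => ?_).trans (le_of_eq ?_)
          · have h : (Matrix.of (Function.update y j z)).row i = (Matrix.of y).row i :=
              Function.update_of_ne hi _ _
            rw [h, h0 i hi]
          · have h : (Matrix.of (Function.update y j z)).row j = z := Function.update_self ..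
            rw [h]
      _ ≤ ENNReal.ofReal (1 / ((d : ℝ) - 2)) :=
          lintegral_inv_sum_sq_mulVec_stdNormal_le (by omega) hU
      _ ≤ _ := by
          refine ENNReal.ofReal_le_ofReal (one_div_le_one_div_of_le ?_ ?_) <;> linarith
  refine (lmarginal_mono hinner 0).trans ?_
  simp [lmarginal]

theorem lintegral_sum_pinvColSq_le {r s : ℕ} (hrs : r + 2 ≤ s) :
    ∫⁻ x, ∑ j, pinvColSq j (matOf x) ∂stdNormal (Fin r × Fin s) ≤
      ENNReal.ofReal ((r : ℝ) / ((s : ℝ) - r - 1)) := by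
  have hrs' : (r : ℝ) + 2 ≤ s := by exact_mod_cast hrs
  have hm : ∀ j : Fin r, Measurable fun x : Fin r × Fin s → ℝ => pinvColSq j (matOf x) :=
    fun j => (measurable_pinvColSq j).comp measurable_matOf
  rw [lintegral_finsetSum _ fun j _ => hm j]
  refine (Finset.sum_le_sum fun j _ => lintegral_pinvColSq_le hrs j).trans (le_of_eq ?_)
  rw [Finset.sum_const, Finset.card_univ, Fintype.card_fin, nsmul_eq_mul,
    ← ENNReal.ofReal_natCast, ← ENNReal.ofReal_mul (by positivity)]
  congr 1
  ring

/-- A standard normal matrix with fewer rows than columns almost surely has full row rank. -/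
theorem ae_mul_pinv_stdNormal {r s : ℕ} (hrs : r + 2 ≤ s) :
    ∀ᵐ x ∂stdNormal (Fin r × Fin s), matOf x * pinv (matOf x) = 1 := by
  have hm : Measurable fun x : Fin r × Fin s → ℝ => ∑ j, pinvColSq j (matOf x) :=
    Finset.measurable_sum _ fun j _ => (measurable_pinvColSq j).comp measurable_matOf
  filter_upwards [ae_lt_top hm ((lintegral_sum_pinvColSq_le hrs).trans_lt
    ENNReal.ofReal_lt_top).ne] with x hx
  ext i j
  have hj := (ENNReal.sum_lt_top.1 hx) j (Finset.mem_univ j)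
  by_contra hne
  rw [pinvColSq, if_neg fun h => hne (h i)] at hj
  exact lt_irrefl _ hj

/-- `𝔼 ‖F†‖² ≤ r / (s - r - 1)` for a standard normal `r × s` matrix `F`. -/
theorem lintegral_norm_pinv_sq_stdNormal_le {r s : ℕ} (hrs : r + 2 ≤ s) :
    ∫⁻ x, ENNReal.ofReal (‖pinv (matOf x)‖ ^ 2) ∂stdNormal (Fin r × Fin s) ≤
      ENNReal.ofReal ((r : ℝ) / ((s : ℝ) - r - 1)) := by
  refine (lintegral_mono fun x => ?_).trans (lintegral_sum_pinvColSq_le hrs)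
  rw [frobenius_norm_sq, Finset.sum_comm,
    ENNReal.ofReal_sum_of_nonneg fun j _ => by positivity]
  refine Finset.sum_le_sum fun j _ => ?_
  rw [pinvColSq]
  split_ifs
  · exact le_rfl
  · exact le_top

/-! ### Second moments of products with a standard normal matrix -/

theorem lintegral_sq_linear_stdNormal {ι : Type*} [Fintype ι] (c : ι → ℝ) :
    ∫⁻ x, ENNReal.ofReal ((∑ i, c i * x i) ^ 2) ∂stdNormal ι = ENNReal.ofReal (∑ i, c i ^ 2) := by
  have hid : MemLp (fun y : ℝ => y) 2 (gaussianReal 0 1) := IsGaussian.memLp_two_id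
  have hL : ∀ i, MemLp (fun x : ι → ℝ => c i * x i) 2 (stdNormal ι) := fun i =>
    (hid.comp_measurePreserving
      (measurePreserving_eval (fun _ : ι => gaussianReal 0 1) i)).const_mul (c i)
  have hS : MemLp (fun x : ι → ℝ => ∑ i, c i * x i) 2 (stdNormal ι) :=
    memLp_finsetSum _ fun i _ => hL i
  have hmean : ∫ x, (∑ i, c i * x i) ∂stdNormal ι = 0 := by
    rw [integral_finsetSum _ fun i _ => (hL i).integrable one_le_two]
    refine Finset.sum_eq_zero fun i _ => ?_
    rw [integral_const_mul]
    have : ∫ x : ι → ℝ, x i ∂stdNormal ι = ∫ y, y ∂gaussianReal 0 1 := by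
      rw [← (measurePreserving_eval (fun _ : ι => gaussianReal 0 1) i).map_eq,
        integral_map (measurable_pi_apply i).aemeasurable (by fun_prop)]
    rw [this, integral_id_gaussianReal, mul_zero]
  have hvar := variance_sum_pi (μ := fun _ : ι => gaussianReal 0 1)
    (X := fun i y => c i * y) (fun i => hid.const_mul (c i))
  rw [← ofReal_integral_eq_lintegral_ofReal hS.integrable_sq (ae_of_all _ fun x => sq_nonneg _)]
  congr 1
  have h := variance_of_integral_eq_zero hS.aemeasurable hmean
  rw [← h]
  have hfun : (fun x : ι → ℝ => ∑ i, c i * x i) = ∑ i, fun x : ι → ℝ => c i * x i := by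
    funext x
    simp
  rw [hfun, hvar]
  refine Finset.sum_congr rfl fun i _ => ?_
  rw [variance_const_mul]
  have : Var[fun y : ℝ => y; gaussianReal 0 1] = 1 := by
    simp
  rw [this, mul_one]

theorem lintegral_norm_mul_mul_sq_stdNormal {l ι σ ρ : Type*} [Fintype l] [Fintype ι] [Fintype σ]
    [Fintype ρ] (C : Matrix l ι ℝ) (H : Matrix σ ρ ℝ) :
    ∫⁻ x, ENNReal.ofReal (‖C * matOf x * H‖ ^ 2) ∂stdNormal (ι × σ) =
      ENNReal.ofReal (‖C‖ ^ 2 * ‖H‖ ^ 2) := by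
  have hentry : ∀ (x : ι × σ → ℝ) a b, (C * matOf x * H) a b =
      ∑ p : ι × σ, (C a p.1 * H p.2 b) * x p := by
    intro x a b
    simp only [Matrix.mul_apply, matOf, Matrix.of_apply, Fintype.sum_prod_type, Finset.sum_mul]
    rw [Finset.sum_comm]
    refine Finset.sum_congr rfl fun i _ => Finset.sum_congr rfl fun j _ => by ring
  have hsq : ∀ x : ι × σ → ℝ, ENNReal.ofReal (‖C * matOf x * H‖ ^ 2) =
      ∑ a, ∑ b, ENNReal.ofReal ((∑ p : ι × σ, (C a p.1 * H p.2 b) * x p) ^ 2) := by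
    intro x
    rw [frobenius_norm_sq, ENNReal.ofReal_sum_of_nonneg fun a _ => by positivity]
    refine Finset.sum_congr rfl fun a _ => ?_
    rw [ENNReal.ofReal_sum_of_nonneg fun a _ => by positivity]
    simp only [hentry]
  simp_rw [hsq]
  have hm : ∀ a b, Measurable fun x : ι × σ → ℝ =>
      ENNReal.ofReal ((∑ p : ι × σ, (C a p.1 * H p.2 b) * x p) ^ 2) := fun a b => by fun_prop
  rw [lintegral_finsetSum _ fun a _ => Finset.measurable_sum _ fun b _ => hm a b]
  simp_rw [lintegral_finsetSum _ fun b _ => hm _ b, lintegral_sq_linear_stdNormal]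
  rw [frobenius_norm_sq C, frobenius_norm_sq H, Finset.sum_comm (f := fun i j => H i j ^ 2)]
  rw [Finset.sum_mul_sum, ENNReal.ofReal_sum_of_nonneg fun a _ => by positivity]
  refine Finset.sum_congr rfl fun a _ => ?_
  rw [ENNReal.ofReal_sum_of_nonneg fun a _ => by positivity]
  refine Finset.sum_congr rfl fun b _ => ?_
  congr 1
  rw [Finset.sum_mul_sum, Fintype.sum_prod_type]
  simp only [mul_pow]

theorem lintegral_norm_pinv_transpose_mul_sq_le {r s : ℕ} (hrs : r + 2 ≤ s) {ι : Type*}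
    [Fintype ι] {W : Matrix ι (Fin r) ℝ} (hW : Wᵀ * W = 1) :
    ∫⁻ x, ENNReal.ofReal (‖pinv (Wᵀ * matOf x)‖ ^ 2) ∂stdNormal (ι × Fin s) ≤
      ENNReal.ofReal ((r : ℝ) / ((s : ℝ) - r - 1)) := by
  have := lintegral_mul_stdNormal (A := Wᵀ) (σ := Fin s) (by rwa [Matrix.transpose_transpose])
    (f := fun F => ENNReal.ofReal (‖pinv F‖ ^ 2)) (by fun_prop)
  rw [this]
  exact lintegral_norm_pinv_sq_stdNormal_le hrs

theorem measurableSet_mul_pinv_eq_one (r s : ℕ) :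
    MeasurableSet {F : Matrix (Fin r) (Fin s) ℝ | F * pinv F = 1} :=
  (measurableSet_singleton (1 : Matrix (Fin r) (Fin r) ℝ)).preimage
    (f := fun F : Matrix (Fin r) (Fin s) ℝ => F * pinv F) (by fun_prop)

theorem ae_transpose_mul_mul_pinv {r s : ℕ} (hrs : r + 2 ≤ s) {ι : Type*}
    [Fintype ι] {W : Matrix ι (Fin r) ℝ} (hW : Wᵀ * W = 1) :
    ∀ᵐ x ∂stdNormal (ι × Fin s), (Wᵀ * matOf x) * pinv (Wᵀ * matOf x) = 1 := by
  set φ : Matrix (Fin r) (Fin s) ℝ → ENNReal := Set.indicator {F | F * pinv F = 1}ᶜ 1 with hφ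
  have hm : Measurable φ := measurable_const.indicator (measurableSet_mul_pinv_eq_one r s).compl
  have hφ0 : ∀ F, φ F = 0 ↔ F * pinv F = 1 := by
    intro F
    simp [hφ, Set.indicator_apply]
  have h := lintegral_mul_stdNormal (A := Wᵀ) (σ := Fin s) (by rwa [Matrix.transpose_transpose]) hm
  have h0 : ∫⁻ y, φ (matOf y) ∂stdNormal (Fin r × Fin s) = 0 := by
    rw [lintegral_eq_zero_iff (by fun_prop)]
    filter_upwards [ae_mul_pinv_stdNormal hrs] with x hx using (hφ0 _).2 hx
  rw [h0, lintegral_eq_zero_iff (by fun_prop)] at h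
  filter_upwards [h] with x hx using (hφ0 _).1 hx

/-- The key estimate of randomized low-rank approximation. If `W` has orthonormal columns and
`C W = 0`, then `C G` and `Wᵀ G` are independent for a standard normal matrix `G`. This is used in
the following form: with an independent copy `G'`, the matrix `W Wᵀ G + (1 - W Wᵀ) G'` is standard
normal, and it gives rise to `Wᵀ G` and `C G'`. -/
theorem lintegral_norm_mul_pinv_sq_le {r s : ℕ} (hrs : r + 2 ≤ s) {l ι : Type*}
    [Fintype l] [Fintype ι] {W : Matrix ι (Fin r) ℝ} (hW : Wᵀ * W = 1) {C : Matrix l ι ℝ}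
    (hC : C * W = 0) :
    ∫⁻ x, ENNReal.ofReal (‖C * matOf x * pinv (Wᵀ * matOf x)‖ ^ 2) ∂stdNormal (ι × Fin s) ≤
      ENNReal.ofReal (‖C‖ ^ 2 * ((r : ℝ) / ((s : ℝ) - r - 1))) := by
  classical
  -- the projection onto the column space of `W`
  set P := W * Wᵀ with hP
  have hPT : Pᵀ = P := by simp [hP, Matrix.transpose_mul]
  have hPP : P * P = P := by
    rw [hP, Matrix.mul_assoc, ← Matrix.mul_assoc Wᵀ, hW, Matrix.one_mul]
  have hWP : Wᵀ * P = Wᵀ := by rw [hP, ← Matrix.mul_assoc, hW, Matrix.one_mul]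
  have hCP : C * P = 0 := by rw [hP, ← Matrix.mul_assoc, hC, Matrix.zero_mul]
  have hA : P * Pᵀ + (1 - P) * (1 - P)ᵀ = 1 := by
    rw [Matrix.transpose_sub, Matrix.transpose_one, hPT, hPP]
    simp [Matrix.sub_mul, Matrix.mul_sub, hPP]
  rw [← lintegral_mul_add_mul_stdNormal (σ := Fin s) hA
    (f := fun G => ENNReal.ofReal (‖C * G * pinv (Wᵀ * G)‖ ^ 2)) (by fun_prop)]
  refine (lintegral_prod_le _).trans ?_
  have hpt : ∀ x x' : ι × Fin s → ℝ,
      C * (P * matOf x + (1 - P) * matOf x') *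
        pinv (Wᵀ * (P * matOf x + (1 - P) * matOf x')) =
      C * matOf x' * pinv (Wᵀ * matOf x) := by
    intro x x'
    simp only [Matrix.mul_add, ← Matrix.mul_assoc, Matrix.mul_sub, Matrix.mul_one, hWP, hCP,
      sub_self, sub_zero, Matrix.zero_mul, zero_add, add_zero]
  simp only [hpt, lintegral_norm_mul_mul_sq_stdNormal]
  simp_rw [ENNReal.ofReal_mul (sq_nonneg ‖C‖)]
  rw [lintegral_const_mul' _ _ ENNReal.ofReal_ne_top]
  gcongr
  exact lintegral_norm_pinv_transpose_mul_sq_le hrs hW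

/-! ### Orthogonal projections -/

theorem frobenius_norm_sq_eq_add_of_orthonormal {m n r : Type*} [Fintype m] [Fintype n]
    [Fintype r] [DecidableEq r] {Q : Matrix m r ℝ} (hQ : Qᵀ * Q = 1) (A : Matrix m n ℝ) :
    ‖A‖ ^ 2 = ‖A - Q * (Qᵀ * A)‖ ^ 2 + ‖Qᵀ * A‖ ^ 2 := by
  have h : ((A - Q * (Qᵀ * A))ᵀ * (Q * (Qᵀ * A))).trace = 0 := by
    have : (A - Q * (Qᵀ * A))ᵀ * Q = 0 := by
      rw [Matrix.transpose_sub, Matrix.sub_mul, Matrix.transpose_mul, Matrix.transpose_mul,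
        Matrix.transpose_transpose, Matrix.mul_assoc, hQ, Matrix.mul_one, sub_self]
    rw [← Matrix.mul_assoc, this, Matrix.zero_mul, Matrix.trace_zero]
  have h2 := frobenius_norm_sq_add h
  rwa [sub_add_cancel, frobenius_norm_orthonormal_mul hQ] at h2

theorem frobenius_norm_transpose_mul_le {m n r : Type*} [Fintype m] [Fintype n]
    [Fintype r] [DecidableEq r] {Q : Matrix m r ℝ} (hQ : Qᵀ * Q = 1) (A : Matrix m n ℝ) :
    ‖Qᵀ * A‖ ^ 2 ≤ ‖A‖ ^ 2 := by
  rw [frobenius_norm_sq_eq_add_of_orthonormal hQ A]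
  exact le_add_of_nonneg_left (sq_nonneg _)

theorem frobenius_norm_sq_orthonormal {m r : Type*} [Fintype m] [Fintype r] [DecidableEq r]
    {Q : Matrix m r ℝ} (hQ : Qᵀ * Q = 1) : ‖Q‖ ^ 2 = Fintype.card r := by
  rw [frobenius_norm_sq_eq_trace, hQ, Matrix.trace_one]

/-- Pythagoras for the approximation of `B` by a matrix `Q T` whose columns lie in the column
space of `Q`. -/
theorem frobenius_norm_sq_sub_orthonormal_mul {m n r : Type*} [Fintype m] [Fintype n]
    [Fintype r] [DecidableEq r] {Q : Matrix m r ℝ} (hQ : Qᵀ * Q = 1) (B : Matrix m n ℝ)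
    (T : Matrix r n ℝ) :
    ‖B - Q * T‖ ^ 2 = ‖B - Q * Qᵀ * B‖ ^ 2 + ‖Qᵀ * B - T‖ ^ 2 := by
  have h1 : Qᵀ * (B - Q * T) = Qᵀ * B - T := by
    rw [Matrix.mul_sub, ← Matrix.mul_assoc, hQ, Matrix.one_mul]
  have h2 : B - Q * T - Q * (Qᵀ * (B - Q * T)) = B - Q * Qᵀ * B := by
    rw [h1, Matrix.mul_sub, Matrix.mul_assoc]
    abel
  rw [frobenius_norm_sq_eq_add_of_orthonormal hQ (B - Q * T), h2, h1]

theorem exists_eq_mul_of_range_le {m n p : ℕ} {A : Matrix (Fin m) (Fin n) ℝ}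
    {B : Matrix (Fin m) (Fin p) ℝ}
    (h : LinearMap.range A.mulVecLin ≤ LinearMap.range B.mulVecLin) :
    ∃ C : Matrix (Fin p) (Fin n) ℝ, A = B * C := by
  have hc : ∀ j, ∃ c, B *ᵥ c = A *ᵥ Pi.single j 1 := fun j =>
    h ⟨Pi.single j 1, rfl⟩
  choose c hc using hc
  refine ⟨Matrix.of fun i j => c j i, ?_⟩
  ext i j
  have := congrFun (hc j) i
  rw [Matrix.mulVec_single_one] at this
  exact this.symm

/-- Both `Q Qᵀ` and `Y Y†` are the orthogonal projection onto the common column space. -/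
theorem mul_transpose_eq_mul_pinv {m s r : ℕ} {Y : Matrix (Fin m) (Fin s) ℝ}
    {Q : Matrix (Fin m) (Fin r) ℝ} (hQ : Qᵀ * Q = 1) {C : Matrix (Fin r) (Fin s) ℝ}
    (hY : Y = Q * C) {D : Matrix (Fin s) (Fin r) ℝ} (hD : Q = Y * D) :
    Q * Qᵀ = Y * pinv Y := by
  obtain ⟨h1, -, h3, -⟩ := pinv_spec Y
  have e1 : Q * Qᵀ * (Y * pinv Y) = Y * pinv Y := by
    have : Q * Qᵀ * Y = Y := by
      rw [hY, Matrix.mul_assoc, ← Matrix.mul_assoc Qᵀ, hQ, Matrix.one_mul]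
    rw [← Matrix.mul_assoc, this]
  have e2 : Y * pinv Y * (Q * Qᵀ) = Q * Qᵀ := by
    have : Y * pinv Y * Q = Q := by
      conv_lhs => rw [hD, ← Matrix.mul_assoc, h1, ← hD]
    rw [← Matrix.mul_assoc, this]
  have e3 := congrArg Matrix.transpose e2
  rw [Matrix.transpose_mul, h3, Matrix.transpose_mul, Matrix.transpose_transpose, e1] at e3
  exact e3.symm

theorem IsOrth.mul_transpose {m s : ℕ} {Y : Matrix (Fin m) (Fin s) ℝ}
    {Q : Matrix (Fin m) (Fin Y.rank) ℝ} (h : IsOrth Y Q) : Q * Qᵀ = Y * pinv Y := by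
  obtain ⟨C, hC⟩ := exists_eq_mul_of_range_le h.range_eq.ge
  obtain ⟨D, hD⟩ := exists_eq_mul_of_range_le h.range_eq.le
  exact mul_transpose_eq_mul_pinv h.orthonormal hC hD

theorem exists_orthonormal_mul_transpose_eq {m s : ℕ} (Y : Matrix (Fin m) (Fin s) ℝ) :
    ∃ r ≤ s, ∃ Q : Matrix (Fin m) (Fin r) ℝ, Qᵀ * Q = 1 ∧ Q * Qᵀ = Y * pinv Y := by
  let w : Fin s → EuclideanSpace ℝ (Fin m) := fun j => WithLp.toLp 2 (Y.col j)
  let K := Submodule.span ℝ (Set.range w)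
  have hspan := finrank_range_le_card (R := ℝ) w
  rw [Set.finrank, Fintype.card_fin] at hspan
  let b := stdOrthonormalBasis ℝ K
  have hin : ∀ x y : EuclideanSpace ℝ (Fin m), inner ℝ x y = x.ofLp ⬝ᵥ y.ofLp := by
    intro x y
    rw [EuclideanSpace.inner_eq_star_dotProduct, star_trivial, dotProduct_comm]
  let Q : Matrix (Fin m) (Fin (Module.finrank ℝ K)) ℝ :=
    Matrix.of fun i a => (b a : EuclideanSpace ℝ (Fin m)).ofLp i
  have hQ : Qᵀ * Q = 1 := by
    ext a c
    rw [Matrix.mul_apply']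
    have h := orthonormal_iff_ite.1 b.orthonormal a c
    rw [Submodule.coe_inner, hin] at h
    rw [Matrix.one_apply, ← h]
    rfl
  have hC : ∃ C : Matrix (Fin (Module.finrank ℝ K)) (Fin s) ℝ, Y = Q * C := by
    have hmem : ∀ j, w j ∈ K := fun j => Submodule.subset_span ⟨j, rfl⟩
    refine ⟨Matrix.of fun a j => b.repr ⟨w j, hmem j⟩ a, ?_⟩
    ext i j
    have h := congrArg (fun v : K => (v : EuclideanSpace ℝ (Fin m)).ofLp i)
      (b.sum_repr ⟨w j, hmem j⟩)
    simp only [Submodule.coe_sum, Submodule.coe_smul, WithLp.ofLp_sum, WithLp.ofLp_smul,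
      Finset.sum_apply, Pi.smul_apply, smul_eq_mul] at h
    rw [Matrix.mul_apply]
    exact h.symm.trans (Finset.sum_congr rfl fun _ _ => mul_comm _ _)
  have hD : ∃ D : Matrix (Fin s) (Fin (Module.finrank ℝ K)) ℝ, Q = Y * D := by
    have hex : ∀ a, ∃ c : Fin s → ℝ, ∑ j, c j • w j = b a := fun a =>
      (Submodule.mem_span_range_iff_exists_fun ℝ).1 (b a).2
    choose c hc using hex
    refine ⟨Matrix.of fun j a => c a j, ?_⟩
    ext i a
    have h := congrArg (fun v : EuclideanSpace ℝ (Fin m) => v.ofLp i) (hc a)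
    simp only [WithLp.ofLp_sum, WithLp.ofLp_smul,
      Finset.sum_apply, Pi.smul_apply, smul_eq_mul] at h
    rw [Matrix.mul_apply]
    exact h.symm.trans (Finset.sum_congr rfl fun _ _ => mul_comm _ _)
  obtain ⟨C, hC⟩ := hC
  obtain ⟨D, hD⟩ := hD
  exact ⟨_, hspan, Q, hQ, mul_transpose_eq_mul_pinv hQ hC hD⟩

theorem pinv_transpose {m n : ℕ} (A : Matrix (Fin m) (Fin n) ℝ) : pinv Aᵀ = (pinv A)ᵀ := by
  obtain ⟨h1, h2, h3, h4⟩ := pinv_spec A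
  refine (pinv_spec Aᵀ).unique ⟨?_, ?_, ?_, ?_⟩
  · rw [← Matrix.transpose_mul, ← Matrix.transpose_mul, ← Matrix.mul_assoc, h1]
  · rw [← Matrix.transpose_mul, ← Matrix.transpose_mul, ← Matrix.mul_assoc, h2]
  · rw [← Matrix.transpose_mul, h4, h4]
  · rw [← Matrix.transpose_mul, h3, h3]

/-- The matrix `Q (A Q)†` depends on the orthonormal basis `Q` only through the projection
`Q Qᵀ`. -/
theorem pinv_mul_projection {l m r : ℕ} {Q : Matrix (Fin m) (Fin r) ℝ} (hQ : Qᵀ * Q = 1)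
    (A : Matrix (Fin l) (Fin m) ℝ) : pinv (A * (Q * Qᵀ)) = Q * pinv (A * Q) := by
  obtain ⟨h1, h2, h3, h4⟩ := pinv_spec (A * Q)
  have hc : ∀ {n : ℕ} (Z : Matrix (Fin r) (Fin n) ℝ), Qᵀ * (Q * Z) = Z := fun Z => by
    rw [← Matrix.mul_assoc, hQ, Matrix.one_mul]
  have hl : A * (Q * Qᵀ) * (Q * pinv (A * Q)) = A * Q * pinv (A * Q) := by
    simp only [Matrix.mul_assoc, hc]
  have hr : Q * pinv (A * Q) * (A * (Q * Qᵀ)) = Q * (pinv (A * Q) * (A * Q)) * Qᵀ := by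
    simp only [Matrix.mul_assoc]
  refine (pinv_spec _).unique ⟨?_, ?_, ?_, ?_⟩
  · rw [hl, ← Matrix.mul_assoc A, ← Matrix.mul_assoc, h1]
  · rw [Matrix.mul_assoc, hl, Matrix.mul_assoc Q, ← Matrix.mul_assoc (pinv _), h2]
  · rw [hl, h3]
  · rw [hr, Matrix.transpose_mul, Matrix.transpose_mul, h4, Matrix.transpose_transpose,
      ← Matrix.mul_assoc]

/-! ### Optimality of truncated singular value decompositions -/

/-- A weighted sum of an antitone family, with weights at most `1` and of total weight at most
`k`, is at most the sum of the first `k` terms. -/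
theorem sum_mul_le_sum_lt {n k : ℕ} {s c : Fin n → ℝ} (hs : Antitone s) (hs0 : ∀ i, 0 ≤ s i)
    (hc0 : ∀ i, 0 ≤ c i) (hc1 : ∀ i, c i ≤ 1) (hc : ∑ i, c i ≤ k) :
    ∑ i, s i * c i ≤ ∑ i, if i.val < k then s i else 0 := by
  by_cases hk : k < n
  · -- compare `s i * c i` with `t * c i` for the threshold value `t`
    set t := s ⟨k, hk⟩ with ht
    have ht0 : 0 ≤ t := hs0 _
    have hpt : ∀ i : Fin n, s i * c i ≤ t * c i + ((if i.val < k then s i else 0) -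
        if i.val < k then t else 0) := by
      intro i
      split_ifs with hi
      · have h1 : t ≤ s i := hs (by simpa [Fin.le_def] using hi.le)
        nlinarith [hc1 i]
      · have h1 : s i ≤ t := hs (by simpa [Fin.le_def] using hi)
        nlinarith [hc0 i]
    have hcount : ∑ i : Fin n, (if i.val < k then t else 0) = k * t := by
      rw [← Finset.sum_filter, Finset.sum_const, nsmul_eq_mul]
      congr 2
      have := Fin.card_filter_val_lt (n := n) (m := k)
      rw [this]
      omega
    calc ∑ i, s i * c i ≤ ∑ i, (t * c i + ((if i.val < k then s i else 0) -
        if i.val < k then t else 0)) := Finset.sum_le_sum fun i _ => hpt i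
      _ = t * ∑ i, c i + ((∑ i : Fin n, if i.val < k then s i else 0) - k * t) := by
        rw [Finset.sum_add_distrib, Finset.sum_sub_distrib, hcount, Finset.mul_sum]
      _ ≤ _ := by nlinarith
  · refine Finset.sum_le_sum fun i _ => ?_
    rw [if_pos (by omega)]
    nlinarith [hs0 i, hc1 i]

/-- Among the matrices `L Rᵀ` with a fixed `R` with orthonormal columns, `A R Rᵀ` is closest to
`A`. -/
theorem frobenius_norm_sq_sub_mul_transpose {m n r : Type*} [Fintype m] [Fintype n] [Fintype r]
    [DecidableEq r] {R : Matrix n r ℝ} (hR : Rᵀ * R = 1) (A : Matrix m n ℝ) (L : Matrix m r ℝ) :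
    ‖A - L * Rᵀ‖ ^ 2 = ‖A‖ ^ 2 - ‖A * R‖ ^ 2 + ‖A * R - L‖ ^ 2 := by
  have h1 : (L * Rᵀ) * (R * Lᵀ) = L * Lᵀ := by
    rw [Matrix.mul_assoc, ← Matrix.mul_assoc Rᵀ, hR, Matrix.one_mul]
  simp only [frobenius_norm_sq_eq_trace', Matrix.transpose_sub, Matrix.transpose_mul,
    Matrix.transpose_transpose, Matrix.sub_mul, Matrix.mul_sub, Matrix.trace_sub, h1]
  simp only [Matrix.mul_assoc]
  ring

/-- The Eckart-Young theorem, for competitors that are given by a rank factorization. -/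
theorem IsTruncatedSVD.norm_sub_le {m n k k' : ℕ} {A T : Matrix (Fin m) (Fin n) ℝ}
    (h : IsTruncatedSVD k A T) (hk : k' ≤ k) (L : Matrix (Fin m) (Fin k') ℝ)
    {R : Matrix (Fin n) (Fin k') ℝ} (hR : Rᵀ * R = 1) : ‖A - T‖ ≤ ‖A - L * Rᵀ‖ := by
  obtain ⟨U, σ, V, hU, hV, hσ, hσ0, hA, hT⟩ := h
  have hAT : ‖A - T‖ ^ 2 = ∑ i, σ i ^ 2 - ∑ i, if i.val < k then σ i ^ 2 else 0 := by
    rw [hA, hT, ← Matrix.sub_mul, ← Matrix.mul_sub, frobenius_norm_mul_orthonormal_transpose hV,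
      frobenius_norm_orthonormal_mul hU, Matrix.diagonal_sub, ← Finset.sum_sub_distrib,
      frobenius_norm_sq]
    refine Finset.sum_congr rfl fun i _ => ?_
    rw [Finset.sum_eq_single i (fun j _ hj => by simp [Matrix.diagonal_apply_ne' _ hj])
      (by simp), Matrix.diagonal_apply_eq]
    split_ifs <;> simp
  have hA2 : ‖A‖ ^ 2 = ∑ i, σ i ^ 2 := by
    rw [hA, frobenius_norm_mul_orthonormal_transpose hV,
      frobenius_norm_orthonormal_mul hU, frobenius_norm_sq]
    refine Finset.sum_congr rfl fun i _ => ?_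
    rw [Finset.sum_eq_single i (fun j _ hj => by simp [Matrix.diagonal_apply_ne' _ hj])
      (by simp), Matrix.diagonal_apply_eq]
  have hAR : ‖A * R‖ ^ 2 = ∑ i, σ i ^ 2 * ∑ j, (Vᵀ * R) i j ^ 2 := by
    rw [hA, Matrix.mul_assoc, Matrix.mul_assoc, frobenius_norm_orthonormal_mul hU,
      frobenius_norm_sq]
    refine Finset.sum_congr rfl fun i _ => ?_
    rw [Finset.mul_sum]
    simp [Matrix.diagonal_mul, mul_pow]
  -- the weights of the `σ i ^ 2` in `‖A * R‖ ^ 2` are at most `1`, and their sum is at most `k`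
  have hc1 : ∀ i, ∑ j, (Vᵀ * R) i j ^ 2 ≤ 1 := by
    intro i
    have h1 := frobenius_norm_transpose_mul_le hR (V.submatrix id fun _ : Unit => i)
    have h2 : ‖V.submatrix id fun _ : Unit => i‖ ^ 2 = 1 := by
      rw [frobenius_norm_sq_eq_trace]
      have := congrFun (congrFun hV i) i
      simpa [Matrix.trace, Matrix.mul_apply] using this
    rw [h2, frobenius_norm_sq] at h1
    refine le_trans (le_of_eq ?_) h1
    refine Finset.sum_congr rfl fun j _ => ?_
    simp [Matrix.mul_apply, mul_comm]
  have hcs : ∑ i, ∑ j, (Vᵀ * R) i j ^ 2 ≤ k := by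
    rw [← frobenius_norm_sq]
    refine (frobenius_norm_transpose_mul_le hV R).trans ?_
    rw [frobenius_norm_sq_orthonormal hR, Fintype.card_fin]
    exact_mod_cast hk
  have hmain := sum_mul_le_sum_lt (s := fun i => σ i ^ 2)
    (fun i j hij => by
      have := hσ hij
      have := hσ0 j
      simp only
      gcongr)
    (fun i => sq_nonneg _) (fun i => by positivity) hc1 hcs
  have hfin : ‖A - T‖ ^ 2 ≤ ‖A - L * Rᵀ‖ ^ 2 := by
    rw [frobenius_norm_sq_sub_mul_transpose hR, hAT, hA2, hAR]
    nlinarith [sq_nonneg ‖A * R - L‖]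
  exact (sq_le_sq₀ (norm_nonneg _) (norm_nonneg _)).1 hfin

/-- A truncated singular value decomposition is the composition with the orthogonal projection
onto the span of the leading right singular vectors. There are `min k (min m n)` of them, hence
the number `k' ≤ k`. -/
theorem IsTruncatedSVD.exists_right_factor {m n k : ℕ} {A T : Matrix (Fin m) (Fin n) ℝ}
    (h : IsTruncatedSVD k A T) :
    ∃ k' ≤ k, ∃ V : Matrix (Fin n) (Fin k') ℝ, Vᵀ * V = 1 ∧ A * V * Vᵀ = T := by
  obtain ⟨U, σ, V, hU, hV, hσ, hσ0, hA, hT⟩ := h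
  have hle : min k (min m n) ≤ min m n := min_le_right _ _
  set e : Fin (min k (min m n)) → Fin (min m n) := Fin.castLE hle with he
  have hinj : Function.Injective e := Fin.castLE_injective hle
  refine ⟨min k (min m n), min_le_left _ _, V.submatrix id e, ?_, ?_⟩
  · ext i j
    have h1 := congrFun (congrFun hV (e i)) (e j)
    have h2 : (1 : Matrix (Fin (min m n)) (Fin (min m n)) ℝ) (e i) (e j) =
        (1 : Matrix (Fin (min k (min m n))) (Fin (min k (min m n))) ℝ) i j := by
      simp only [Matrix.one_apply, hinj.eq_iff]
    rw [← h2, ← h1]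
    simp [Matrix.mul_apply]
  · have hVe : Vᵀ * V.submatrix id e =
        (1 : Matrix (Fin (min m n)) (Fin (min m n)) ℝ).submatrix id e := by
      rw [← hV]
      ext i j
      simp [Matrix.mul_apply]
    have hD : Matrix.diagonal σ *
        (1 : Matrix (Fin (min m n)) (Fin (min m n)) ℝ).submatrix id e * (V.submatrix id e)ᵀ =
        Matrix.diagonal (fun i => if i.val < k then σ i else 0) * Vᵀ := by
      ext i j
      rw [Matrix.mul_apply, Matrix.diagonal_mul]
      simp only [Matrix.diagonal_mul, Matrix.submatrix_apply, id, Matrix.transpose_apply]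
      split_ifs with hi
      · have hik : i.val < min k (min m n) := lt_min hi i.2
        rw [Finset.sum_eq_single ⟨i.val, hik⟩]
        · have : e ⟨i.val, hik⟩ = i := rfl
          rw [this]
          change σ i * (1 : Matrix (Fin (min m n)) (Fin (min m n)) ℝ) i i * V j i = _
          rw [Matrix.one_apply_eq, mul_one]
        · intro a _ ha
          have : i ≠ e a := by
            rintro rfl
            exact ha rfl
          simp [this]
        · simp
      · rw [zero_mul]
        refine Finset.sum_eq_zero fun a _ => ?_
        have : i ≠ e a := by
          rintro rfl
          exact hi (lt_of_lt_of_le a.2 (min_le_left _ _))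
        simp [this]
    rw [hA, hT, Matrix.mul_assoc (U * _), hVe, Matrix.mul_assoc U, Matrix.mul_assoc U, hD,
      ← Matrix.mul_assoc]

/-! ### Deterministic error bounds -/

/-- A truncated singular value decomposition of a perturbation of `Qᵀ B` is nearly as good as any
competitor of rank at most `k` in the column space of `Q`. -/
theorem IsTruncatedSVD.norm_sub_orthonormal_mul_le {m n r k k' : ℕ} {B : Matrix (Fin m) (Fin n) ℝ}
    {Q : Matrix (Fin m) (Fin r) ℝ} (hQ : Qᵀ * Q = 1) {X T : Matrix (Fin r) (Fin n) ℝ}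
    (hT : IsTruncatedSVD k X T) (hk : k' ≤ k) (L : Matrix (Fin r) (Fin k') ℝ)
    {V : Matrix (Fin n) (Fin k') ℝ} (hV : Vᵀ * V = 1) :
    ‖B - Q * T‖ ≤ ‖B - Q * (L * Vᵀ)‖ + 2 * ‖X - Qᵀ * B‖ := by
  have h1 := frobenius_norm_sq_sub_orthonormal_mul hQ B T
  have h2 := frobenius_norm_sq_sub_orthonormal_mul hQ B (L * Vᵀ)
  have h3 := hT.norm_sub_le hk L hV
  have h4 : ‖Qᵀ * B - T‖ ≤ ‖X - Qᵀ * B‖ + ‖X - T‖ := by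
    rw [norm_sub_rev X (Qᵀ * B)]
    exact norm_sub_le_norm_sub_add_norm_sub _ _ _
  have h5 : ‖X - L * Vᵀ‖ ≤ ‖X - Qᵀ * B‖ + ‖Qᵀ * B - L * Vᵀ‖ :=
    norm_sub_le_norm_sub_add_norm_sub _ _ _
  set e := ‖B - Q * (L * Vᵀ)‖
  set t := ‖Qᵀ * B - L * Vᵀ‖
  set z := ‖X - Qᵀ * B‖
  set w := ‖Qᵀ * B - T‖
  have hz : 0 ≤ z := norm_nonneg _
  have he : 0 ≤ e := norm_nonneg _
  have ht : 0 ≤ t := norm_nonneg _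
  have hw : 0 ≤ w := norm_nonneg _
  have hte : t ≤ e := by
    refine (sq_le_sq₀ ht he).1 ?_
    rw [h2]
    exact le_add_of_nonneg_left (sq_nonneg _)
  have hw2 : w ≤ t + 2 * z := by linarith
  refine (sq_le_sq₀ (norm_nonneg _) (by positivity)).1 ?_
  nlinarith [mul_le_mul_of_nonneg_left hte hz, mul_self_le_mul_self hw hw2]

/-- The error of the core matrix `(Ψᵀ Q)† (Ψᵀ B + Ψ'ᵀ N)`, expressed in terms of `Y` only by
means of the orthogonal projection `Y Y† = Q Qᵀ` onto the column space of `Y`. -/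
noncomputable def coreError {m₁ m₂ q s t : ℕ} (B : Matrix (Fin m₁) (Fin m₂) ℝ)
    (N : Matrix (Fin q) (Fin m₂) ℝ) (Y : Matrix (Fin m₁) (Fin s) ℝ)
    (Psi : Matrix (Fin m₁) (Fin t) ℝ) (Psi' : Matrix (Fin q) (Fin t) ℝ) : ℝ :=
  ‖pinv (Psiᵀ * (Y * pinv Y)) * (Psiᵀ * (B - Y * pinv Y * B) + Psi'ᵀ * N)‖

theorem coreError_eq {m₁ m₂ q s t r : ℕ} (B : Matrix (Fin m₁) (Fin m₂) ℝ)
    (N : Matrix (Fin q) (Fin m₂) ℝ) {Y : Matrix (Fin m₁) (Fin s) ℝ}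
    (Psi : Matrix (Fin m₁) (Fin t) ℝ) (Psi' : Matrix (Fin q) (Fin t) ℝ)
    {Q : Matrix (Fin m₁) (Fin r) ℝ} (hQ : Qᵀ * Q = 1) (hY : Q * Qᵀ = Y * pinv Y) :
    coreError B N Y Psi Psi' =
      ‖pinv (Psiᵀ * Q) * (Psiᵀ * (B - Q * Qᵀ * B) + Psi'ᵀ * N)‖ := by
  rw [coreError, ← hY, pinv_mul_projection hQ, Matrix.mul_assoc Q,
    frobenius_norm_orthonormal_mul hQ]

/-- If `Ψᵀ Q` has full column rank, stated as `hPsi` in terms of `Y Y† = Q Qᵀ`, then the core matrix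
reproduces the part `Q Qᵀ B` of `B`. -/
theorem norm_core_sub_eq {m₁ m₂ q s t r : ℕ} (B : Matrix (Fin m₁) (Fin m₂) ℝ)
    (N : Matrix (Fin q) (Fin m₂) ℝ) {Y : Matrix (Fin m₁) (Fin s) ℝ}
    {Psi : Matrix (Fin m₁) (Fin t) ℝ} (Psi' : Matrix (Fin q) (Fin t) ℝ)
    {Q : Matrix (Fin m₁) (Fin r) ℝ} (hQ : Qᵀ * Q = 1) (hY : Q * Qᵀ = Y * pinv Y)
    (hPsi : pinv (Psiᵀ * (Y * pinv Y)) * (Psiᵀ * (Y * pinv Y)) = Y * pinv Y) :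
    ‖pinv (Psiᵀ * Q) * (Psiᵀ * B + Psi'ᵀ * N) - Qᵀ * B‖ = coreError B N Y Psi Psi' := by
  rw [coreError_eq B N Psi Psi' hQ hY]
  rw [← hY, pinv_mul_projection hQ] at hPsi
  have hone : pinv (Psiᵀ * Q) * (Psiᵀ * Q) = 1 := by
    have h := congrArg (fun Z => Qᵀ * Z * Q) hPsi
    calc pinv (Psiᵀ * Q) * (Psiᵀ * Q)
        = (Qᵀ * Q) * pinv (Psiᵀ * Q) * (Psiᵀ * Q) * (Qᵀ * Q) := by
          rw [hQ, Matrix.one_mul, Matrix.mul_one]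
      _ = Qᵀ * (Q * pinv (Psiᵀ * Q) * (Psiᵀ * (Q * Qᵀ))) * Q := by
          simp only [Matrix.mul_assoc]
      _ = (Qᵀ * Q) * (Qᵀ * Q) := by rw [h]; simp only [Matrix.mul_assoc]
      _ = 1 := by rw [hQ, Matrix.one_mul]
  have hQB : Qᵀ * B = pinv (Psiᵀ * Q) * (Psiᵀ * (Q * Qᵀ * B)) := by
    calc Qᵀ * B = pinv (Psiᵀ * Q) * (Psiᵀ * Q) * (Qᵀ * B) := by rw [hone, Matrix.one_mul]
      _ = _ := by simp only [Matrix.mul_assoc]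
  congr 1
  rw [hQB, ← Matrix.mul_sub, Matrix.mul_sub Psiᵀ]
  congr 1
  abel

/-- The error of the competitor `B Ω F† Vᵀ`, with `F = Vᵀ Ω`: as `F F† = 1`, this competitor has
the same restriction to the span of the columns of `V` as `B`. -/
theorem norm_sub_competitor_sq {m₁ m₂ k s : ℕ} {B Bk : Matrix (Fin m₁) (Fin m₂) ℝ}
    {V : Matrix (Fin m₂) (Fin k) ℝ} (hV : Vᵀ * V = 1) (hBk : B * V * Vᵀ = Bk)
    {Om : Matrix (Fin m₂) (Fin s) ℝ} (hF : (Vᵀ * Om) * pinv (Vᵀ * Om) = 1) :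
    ‖B - B * Om * pinv (Vᵀ * Om) * Vᵀ‖ ^ 2 =
      ‖B - Bk‖ ^ 2 + ‖(B - Bk) * Om * pinv (Vᵀ * Om)‖ ^ 2 := by
  have hV0 : (B - Bk) * V = 0 := by
    rw [Matrix.sub_mul, ← hBk, Matrix.mul_assoc (B * V), hV, Matrix.mul_one, sub_self]
  have hBkF : Bk * Om * pinv (Vᵀ * Om) * Vᵀ = Bk := by
    calc Bk * Om * pinv (Vᵀ * Om) * Vᵀ = B * V * ((Vᵀ * Om) * pinv (Vᵀ * Om)) * Vᵀ := by
          rw [← hBk]; simp only [Matrix.mul_assoc]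
      _ = Bk := by rw [hF, Matrix.mul_one, hBk]
  have h : B - B * Om * pinv (Vᵀ * Om) * Vᵀ =
      (B - Bk) - (B - Bk) * Om * pinv (Vᵀ * Om) * Vᵀ := by
    rw [Matrix.sub_mul, Matrix.sub_mul, Matrix.sub_mul, hBkF]
    abel
  rw [h, frobenius_norm_sq_sub_mul_transpose hV, hV0]
  simp

theorem norm_sub_noisy_competitor_le {m₁ m₂ p k s : ℕ} {B Bk : Matrix (Fin m₁) (Fin m₂) ℝ}
    (M : Matrix (Fin m₁) (Fin p) ℝ)
    {V : Matrix (Fin m₂) (Fin k) ℝ} (hV : Vᵀ * V = 1) (hBk : B * V * Vᵀ = Bk)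
    {Om : Matrix (Fin m₂) (Fin s) ℝ} (Om' : Matrix (Fin p) (Fin s) ℝ)
    (hF : (Vᵀ * Om) * pinv (Vᵀ * Om) = 1) :
    ‖B - (B * Om + M * Om') * pinv (Vᵀ * Om) * Vᵀ‖ ≤
      √(‖B - Bk‖ ^ 2 + ‖(B - Bk) * Om * pinv (Vᵀ * Om)‖ ^ 2) +
        ‖M * Om' * pinv (Vᵀ * Om)‖ := by
  rw [← norm_sub_competitor_sq hV hBk hF, Real.sqrt_sq (norm_nonneg _),
    ← frobenius_norm_mul_orthonormal_transpose hV (M * Om' * pinv (Vᵀ * Om)),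
    Matrix.add_mul, Matrix.add_mul, ← sub_sub]
  exact norm_sub_le _ _

/-- The projection of `B` onto the column space of `Y` is at least as close to `B` as any competitor
in this column space. -/
theorem norm_sub_projection_le {m₁ m₂ s k : ℕ} (B : Matrix (Fin m₁) (Fin m₂) ℝ)
    (Y : Matrix (Fin m₁) (Fin s) ℝ) (L : Matrix (Fin s) (Fin k) ℝ)
    (V : Matrix (Fin m₂) (Fin k) ℝ) :
    ‖B - Y * pinv Y * B‖ ≤ ‖B - Y * L * Vᵀ‖ := by
  obtain ⟨r, -, Q, hQ, hY⟩ := exists_orthonormal_mul_transpose_eq Y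
  have hYQ : Q * (Qᵀ * (Y * L * Vᵀ)) = Y * L * Vᵀ := by
    rw [← Matrix.mul_assoc Q, hY, Matrix.mul_assoc Y L, ← Matrix.mul_assoc (Y * pinv Y),
      (pinv_spec Y).mul_mul_self]
  have h := frobenius_norm_sq_sub_orthonormal_mul hQ B (Qᵀ * (Y * L * Vᵀ))
  rw [hYQ, hY] at h
  refine (sq_le_sq₀ (norm_nonneg _) (norm_nonneg _)).1 ?_
  rw [h]
  exact le_add_of_nonneg_right (sq_nonneg _)

/-- The error of the sketched low-rank approximation, compared with the matrix
`Y F† Vᵀ = Q (Qᵀ Y F†) Vᵀ`. -/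
theorem IsOrth.norm_sub_mul_truncated_le {m₁ m₂ q s t k k' : ℕ} {B : Matrix (Fin m₁) (Fin m₂) ℝ}
    {N : Matrix (Fin q) (Fin m₂) ℝ} {Y : Matrix (Fin m₁) (Fin s) ℝ}
    {Psi : Matrix (Fin m₁) (Fin t) ℝ} {Psi' : Matrix (Fin q) (Fin t) ℝ}
    {Q : Matrix (Fin m₁) (Fin Y.rank) ℝ} (hQ : IsOrth Y Q)
    (hPsi : pinv (Psiᵀ * (Y * pinv Y)) * (Psiᵀ * (Y * pinv Y)) = Y * pinv Y)
    {T : Matrix (Fin Y.rank) (Fin m₂) ℝ}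
    (hT : IsTruncatedSVD k (pinv (Psiᵀ * Q) * (Psiᵀ * B + Psi'ᵀ * N)) T) (hk : k' ≤ k)
    (L : Matrix (Fin s) (Fin k') ℝ) {V : Matrix (Fin m₂) (Fin k') ℝ} (hV : Vᵀ * V = 1) :
    ‖B - Q * T‖ ≤ ‖B - Y * L * Vᵀ‖ + 2 * coreError B N Y Psi Psi' := by
  have h := hT.norm_sub_orthonormal_mul_le (B := B) hQ.orthonormal hk (Qᵀ * (Y * L)) hV
  have hYQ : Q * (Qᵀ * (Y * L) * Vᵀ) = Y * L * Vᵀ := by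
    rw [← Matrix.mul_assoc, ← Matrix.mul_assoc, hQ.mul_transpose, ← Matrix.mul_assoc,
      (pinv_spec Y).mul_mul_self]
  rwa [hYQ, norm_core_sub_eq B N Psi' hQ.orthonormal hQ.mul_transpose hPsi] at h

/-! ### Expected errors -/

theorem ae_pinv_transpose_mul_projection {m s t : ℕ} (hst : s + 2 ≤ t)
    (Y : Matrix (Fin m) (Fin s) ℝ) :
    ∀ᵐ y ∂stdNormal (Fin m × Fin t),
      pinv ((matOf y)ᵀ * (Y * pinv Y)) * ((matOf y)ᵀ * (Y * pinv Y)) = Y * pinv Y := by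
  obtain ⟨r, hr, Q, hQ, hY⟩ := exists_orthonormal_mul_transpose_eq Y
  filter_upwards [ae_transpose_mul_mul_pinv (by omega : r + 2 ≤ t) hQ] with y hy
  have h : pinv ((matOf y)ᵀ * Q) * ((matOf y)ᵀ * Q) = 1 := by
    have := congrArg Matrix.transpose hy
    rwa [Matrix.transpose_mul, ← pinv_transpose, Matrix.transpose_mul, Matrix.transpose_transpose,
      Matrix.transpose_one] at this
  rw [← hY, pinv_mul_projection hQ]
  calc Q * pinv ((matOf y)ᵀ * Q) * ((matOf y)ᵀ * (Q * Qᵀ))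
      = Q * (pinv ((matOf y)ᵀ * Q) * ((matOf y)ᵀ * Q)) * Qᵀ := by simp only [Matrix.mul_assoc]
    _ = Q * Qᵀ := by rw [h, Matrix.mul_one]

/-- The expected squared error of the core matrix, for a fixed range sketch `Y`. -/
theorem lintegral_coreError_sq_le {m₁ m₂ q s t : ℕ} (hst : s + 2 ≤ t)
    (B : Matrix (Fin m₁) (Fin m₂) ℝ) (N : Matrix (Fin q) (Fin m₂) ℝ)
    (Y : Matrix (Fin m₁) (Fin s) ℝ) :
    ∫⁻ y, ENNReal.ofReal (coreError B N Y (matOf y.1) (matOf y.2) ^ 2)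
        ∂(stdNormal (Fin m₁ × Fin t)).prod (stdNormal (Fin q × Fin t)) ≤
      ENNReal.ofReal ((‖B - Y * pinv Y * B‖ ^ 2 + ‖N‖ ^ 2) * ((s : ℝ) / ((t : ℝ) - s - 1))) := by
  obtain ⟨r, hr, Q, hQ, hY⟩ := exists_orthonormal_mul_transpose_eq Y
  set D := B - Q * Qᵀ * B with hD
  have hDQ : Dᵀ * Q = 0 := by
    rw [hD, Matrix.transpose_sub, Matrix.sub_mul, Matrix.transpose_mul, Matrix.transpose_mul,
      Matrix.transpose_transpose, Matrix.mul_assoc, Matrix.mul_assoc, hQ, Matrix.mul_one, sub_self]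
  -- stack the two sketches: `[Ψ; Ψ']` is standard normal, `Wᵀ` and `C` act on it
  set W : Matrix (Fin m₁ ⊕ Fin q) (Fin r) ℝ := Matrix.fromRows Q 0 with hWdef
  set C : Matrix (Fin m₂) (Fin m₁ ⊕ Fin q) ℝ := Matrix.fromCols Dᵀ Nᵀ with hCdef
  have hWT : Wᵀ = Matrix.fromCols Qᵀ 0 := by
    rw [hWdef, Matrix.transpose_fromRows, Matrix.transpose_zero]
  have hW : Wᵀ * W = 1 := by
    rw [hWT, hWdef, Matrix.fromCols_mul_fromRows, hQ, Matrix.zero_mul, add_zero]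
  have hC : C * W = 0 := by
    rw [hCdef, hWdef, Matrix.fromCols_mul_fromRows, hDQ, Matrix.mul_zero, add_zero]
  have hCn : ‖C‖ ^ 2 = ‖D‖ ^ 2 + ‖N‖ ^ 2 := by
    rw [hCdef, frobenius_norm_sq_fromCols, Matrix.frobenius_norm_transpose,
      Matrix.frobenius_norm_transpose]
  set A : Matrix (Fin m₁ ⊕ Fin q) (Fin m₁) ℝ := Matrix.fromRows 1 0 with hAdef
  set A' : Matrix (Fin m₁ ⊕ Fin q) (Fin q) ℝ := Matrix.fromRows 0 1 with hAdef'
  have hA : A * Aᵀ + A' * A'ᵀ = 1 := by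
    rw [hAdef, hAdef', Matrix.transpose_fromRows, Matrix.transpose_fromRows,
      Matrix.fromRows_mul_fromCols, Matrix.fromRows_mul_fromCols, Matrix.fromBlocks_add]
    simp
  have hG := lintegral_mul_add_mul_stdNormal (σ := Fin t) hA
    (f := fun G => ENNReal.ofReal (‖C * G * pinv (Wᵀ * G)‖ ^ 2)) (by fun_prop)
  have hpt : ∀ y : (Fin m₁ × Fin t → ℝ) × (Fin q × Fin t → ℝ),
      coreError B N Y (matOf y.1) (matOf y.2) =
        ‖C * (A * matOf y.1 + A' * matOf y.2) * pinv (Wᵀ * (A * matOf y.1 + A' * matOf y.2))‖ := by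
    intro y
    have h1 : A * matOf y.1 + A' * matOf y.2 = Matrix.fromRows (matOf y.1) (matOf y.2) := by
      rw [hAdef, hAdef', Matrix.fromRows_mul, Matrix.fromRows_mul]
      ext (i | i) j <;> simp
    rw [h1, coreError_eq B N _ _ hQ hY, hWT, hCdef, Matrix.fromCols_mul_fromRows,
      Matrix.fromCols_mul_fromRows, Matrix.zero_mul, add_zero, ← Matrix.frobenius_norm_transpose,
      Matrix.transpose_mul, Matrix.transpose_add, Matrix.transpose_mul, Matrix.transpose_mul,
      Matrix.transpose_transpose, Matrix.transpose_transpose, ← pinv_transpose,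
      Matrix.transpose_mul, Matrix.transpose_transpose]
  simp_rw [hpt]
  rw [hG]
  refine (lintegral_norm_mul_pinv_sq_le (by omega : r + 2 ≤ t) hW hC).trans ?_
  rw [hCn, ← hY]
  refine ENNReal.ofReal_le_ofReal ?_
  have hr' : (r : ℝ) ≤ s := by exact_mod_cast hr
  have hst' : (s : ℝ) + 2 ≤ t := by exact_mod_cast hst
  gcongr
  linarith

theorem measurable_coreError {α : Type*} [MeasurableSpace α] {m₁ m₂ q s t : ℕ}
    (B : Matrix (Fin m₁) (Fin m₂) ℝ) (N : Matrix (Fin q) (Fin m₂) ℝ)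
    {Y : α → Matrix (Fin m₁) (Fin s) ℝ} (hY : Measurable Y)
    {Psi : α → Matrix (Fin m₁) (Fin t) ℝ} (hPsi : Measurable Psi)
    {Psi' : α → Matrix (Fin q) (Fin t) ℝ} (hPsi' : Measurable Psi') :
    Measurable fun x => coreError B N (Y x) (Psi x) (Psi' x) := by
  unfold coreError
  fun_prop

theorem lintegral_prod_fst {α β : Type*} [MeasurableSpace α] [MeasurableSpace β] (μ : Measure α)
    (ν : Measure β) [IsProbabilityMeasure ν] {f : α → ENNReal} (hf : Measurable f) :
    ∫⁻ x, f x.1 ∂μ.prod ν = ∫⁻ x, f x ∂μ :=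
  measurePreserving_fst.lintegral_comp hf

theorem ae_prod_fst {α β : Type*} [MeasurableSpace α] [MeasurableSpace β] {μ : Measure α}
    (ν : Measure β) [IsProbabilityMeasure ν] {p : α → Prop} (h : ∀ᵐ x ∂μ, p x) :
    ∀ᵐ x ∂μ.prod ν, p x.1 :=
  Measure.quasiMeasurePreserving_fst.ae h

/-- The variant of `lintegral_norm_mul_pinv_sq_le` with two independent standard normal matrices. -/
theorem lintegral_norm_mul_pinv_sq_indep_le {r s : ℕ} (hrs : r + 2 ≤ s) {l ι κ : Type*}
    [Fintype l] [Fintype ι] [Fintype κ] {W : Matrix ι (Fin r) ℝ} (hW : Wᵀ * W = 1)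
    (M : Matrix l κ ℝ) :
    ∫⁻ x, ENNReal.ofReal (‖M * matOf x.2 * pinv (Wᵀ * matOf x.1)‖ ^ 2)
        ∂(stdNormal (ι × Fin s)).prod (stdNormal (κ × Fin s)) ≤
      ENNReal.ofReal (‖M‖ ^ 2 * ((r : ℝ) / ((s : ℝ) - r - 1))) := by
  refine (lintegral_prod_le _).trans ?_
  simp only [lintegral_norm_mul_mul_sq_stdNormal]
  simp_rw [ENNReal.ofReal_mul (sq_nonneg ‖M‖)]
  rw [lintegral_const_mul' _ _ ENNReal.ofReal_ne_top]
  gcongr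
  exact lintegral_norm_pinv_transpose_mul_sq_le hrs hW

theorem div_sub_sub_one_le {k k' s : ℕ} (hk : k' ≤ k) (hs : k + 2 ≤ s) :
    (k' : ℝ) / ((s : ℝ) - k' - 1) ≤ (k : ℝ) / ((s : ℝ) - k - 1) := by
  have hk' : (k' : ℝ) ≤ k := by exact_mod_cast hk
  have hs' : (k : ℝ) + 2 ≤ s := by exact_mod_cast hs
  gcongr
  linarith

theorem lintegral_norm_sub_competitor_sq_le {k s : ℕ} (hks : k + 2 ≤ s) {l ι : Type*}
    [Fintype l] [Fintype ι] {V : Matrix ι (Fin k) ℝ} (hV : Vᵀ * V = 1) {D : Matrix l ι ℝ}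
    (hD : D * V = 0) :
    ∫⁻ x, ENNReal.ofReal (√(‖D‖ ^ 2 + ‖D * matOf x * pinv (Vᵀ * matOf x)‖ ^ 2) ^ 2)
        ∂stdNormal (ι × Fin s) ≤
      ENNReal.ofReal ((1 + (k : ℝ) / ((s : ℝ) - k - 1)) * ‖D‖ ^ 2) := by
  have hks' : (k : ℝ) + 2 ≤ s := by exact_mod_cast hks
  have hden : 0 < (s : ℝ) - k - 1 := by linarith
  have hpt : ∀ x : ι × Fin s → ℝ,
      ENNReal.ofReal (√(‖D‖ ^ 2 + ‖D * matOf x * pinv (Vᵀ * matOf x)‖ ^ 2) ^ 2) =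
        ENNReal.ofReal (‖D‖ ^ 2) +
          ENNReal.ofReal (‖D * matOf x * pinv (Vᵀ * matOf x)‖ ^ 2) := fun x => by
    rw [Real.sq_sqrt (by positivity), ENNReal.ofReal_add (by positivity) (by positivity)]
  simp_rw [hpt]
  rw [lintegral_add_left measurable_const, lintegral_const, measure_univ, mul_one]
  refine (add_le_add le_rfl (lintegral_norm_mul_pinv_sq_le hks hV hD)).trans (le_of_eq ?_)
  rw [← ENNReal.ofReal_add (by positivity) (by positivity)]
  congr 1
  ring

/-- The probabilistic content of the error bound, on the canonical sample space: almost surely the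
error is at most `a + b` with `𝔼 a² ≤ E₁` and `𝔼 b² ≤ E₂`. Here `a` is the error of the competitor
`B Ω F† Vᵀ`, and `b` is made up of the norm of `M Ω' F†` and of twice the error of the core
matrix. -/
theorem exists_error_bounds {m₁ m₂ p q k sR sL : ℕ} (hsR : 2 * k + 1 < sR) (hsL : 2 * sR + 1 < sL)
    (B : Matrix (Fin m₁) (Fin m₂) ℝ) (M : Matrix (Fin m₁) (Fin p) ℝ)
    (N : Matrix (Fin q) (Fin m₂) ℝ) {Bk : Matrix (Fin m₁) (Fin m₂) ℝ}
    (hBk : IsTruncatedSVD k B Bk) :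
    ∃ a b : ((Fin m₂ × Fin sR → ℝ) × (Fin p × Fin sR → ℝ)) ×
        ((Fin m₁ × Fin sL → ℝ) × (Fin q × Fin sL → ℝ)) → ℝ,
      Measurable a ∧ Measurable b ∧ (∀ x, 0 ≤ a x) ∧ (∀ x, 0 ≤ b x) ∧
      ∫⁻ x, ENNReal.ofReal (a x ^ 2)
        ∂((stdNormal (Fin m₂ × Fin sR)).prod (stdNormal (Fin p × Fin sR))).prod
          ((stdNormal (Fin m₁ × Fin sL)).prod (stdNormal (Fin q × Fin sL))) ≤
        ENNReal.ofReal ((1 + (k : ℝ) / ((sR : ℝ) - k - 1)) * ‖B - Bk‖ ^ 2) ∧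
      ∫⁻ x, ENNReal.ofReal (b x ^ 2)
        ∂((stdNormal (Fin m₂ × Fin sR)).prod (stdNormal (Fin p × Fin sR))).prod
          ((stdNormal (Fin m₁ × Fin sL)).prod (stdNormal (Fin q × Fin sL))) ≤
        ENNReal.ofReal (18 * (k : ℝ) / ((sR : ℝ) - k - 1) * ‖M‖ ^ 2
          + 8 * (sR : ℝ) / ((sL : ℝ) - sR - 1) * ‖N‖ ^ 2
          + 32 * (sR : ℝ) / ((sL : ℝ) - sR - 1) * ‖B - Bk‖ ^ 2) ∧
      ∀ᵐ x ∂((stdNormal (Fin m₂ × Fin sR)).prod (stdNormal (Fin p × Fin sR))).prod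
          ((stdNormal (Fin m₁ × Fin sL)).prod (stdNormal (Fin q × Fin sL))),
        ∀ Q, IsOrth (B * matOf x.1.1 + M * matOf x.1.2) Q →
        ∀ T, IsTruncatedSVD k (pinv ((matOf x.2.1)ᵀ * Q) *
          ((matOf x.2.1)ᵀ * B + (matOf x.2.2)ᵀ * N)) T →
        ‖B - Q * T‖ ≤ a x + b x := by
  obtain ⟨k', hk', V, hV, hBV⟩ := hBk.exists_right_factor
  have hk2 : k' + 2 ≤ sR := by omega
  have hDV : (B - Bk) * V = 0 := by
    rw [Matrix.sub_mul, ← hBV, Matrix.mul_assoc (B * V), hV, Matrix.mul_one, sub_self]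
  set μ₁ := (stdNormal (Fin m₂ × Fin sR)).prod (stdNormal (Fin p × Fin sR)) with hμ₁
  set μ₂ := (stdNormal (Fin m₁ × Fin sL)).prod (stdNormal (Fin q × Fin sL)) with hμ₂
  -- the competitor's error, the effect of `M` on it, and the error of the core matrix
  let a₁ : (Fin m₂ × Fin sR → ℝ) → ℝ := fun x =>
    √(‖B - Bk‖ ^ 2 + ‖(B - Bk) * matOf x * pinv (Vᵀ * matOf x)‖ ^ 2)
  let c : (Fin m₂ × Fin sR → ℝ) × (Fin p × Fin sR → ℝ) → ℝ := fun x =>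
    ‖M * matOf x.2 * pinv (Vᵀ * matOf x.1)‖
  let Y : (Fin m₂ × Fin sR → ℝ) × (Fin p × Fin sR → ℝ) → Matrix (Fin m₁) (Fin sR) ℝ := fun x =>
    B * matOf x.1 + M * matOf x.2
  let z : ((Fin m₂ × Fin sR → ℝ) × (Fin p × Fin sR → ℝ)) ×
      ((Fin m₁ × Fin sL → ℝ) × (Fin q × Fin sL → ℝ)) → ℝ := fun x =>
    coreError B N (Y x.1) (matOf x.2.1) (matOf x.2.2)
  have ha₁m : Measurable a₁ := by fun_prop
  have hcm : Measurable c := by fun_prop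
  have hYm : Measurable Y := by fun_prop
  have hzm : Measurable z := measurable_coreError B N (by fun_prop) (by fun_prop) (by fun_prop)
  have hz0 : ∀ x, 0 ≤ z x := fun x => norm_nonneg _
  have hc0 : ∀ x, 0 ≤ c x := fun x => norm_nonneg _
  have ha0 : ∀ x, 0 ≤ a₁ x := fun x => Real.sqrt_nonneg _
  set κ : ℝ := (k : ℝ) / ((sR : ℝ) - k - 1) with hκ
  set ρ : ℝ := (sR : ℝ) / ((sL : ℝ) - sR - 1) with hρ
  have hsR' : 2 * (k : ℝ) + 2 ≤ sR := by exact_mod_cast hsR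
  have hsL' : 2 * (sR : ℝ) + 2 ≤ sL := by exact_mod_cast hsL
  have hk0 : (0 : ℝ) ≤ k := Nat.cast_nonneg k
  have hdR : 0 < (sR : ℝ) - k - 1 := by linarith
  have hdL : 0 < (sL : ℝ) - sR - 1 := by linarith
  have hκ0 : 0 ≤ κ := by positivity
  have hρ0 : 0 ≤ ρ := by positivity
  have hκ1 : κ ≤ 1 := by rw [hκ, div_le_one hdR]; linarith
  have hρ1 : ρ ≤ 1 := by rw [hρ, div_le_one hdL]; linarith
  have hκ' : (k' : ℝ) / ((sR : ℝ) - k' - 1) ≤ κ := div_sub_sub_one_le hk' (by omega)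
  have hIa : ∫⁻ x, ENNReal.ofReal (a₁ x.1 ^ 2) ∂μ₁ ≤
      ENNReal.ofReal ((1 + κ) * ‖B - Bk‖ ^ 2) := by
    rw [hμ₁, lintegral_prod_fst _ _ (f := fun x => ENNReal.ofReal (a₁ x ^ 2)) (by fun_prop)]
    refine (lintegral_norm_sub_competitor_sq_le hk2 hV hDV).trans ?_
    gcongr
  have hIc : ∫⁻ x, ENNReal.ofReal (c x ^ 2) ∂μ₁ ≤ ENNReal.ofReal (‖M‖ ^ 2 * κ) := by
    refine (lintegral_norm_mul_pinv_sq_indep_le hk2 hV M).trans ?_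
    gcongr
  have hF : ∀ᵐ x ∂μ₁, (Vᵀ * matOf x.1) * pinv (Vᵀ * matOf x.1) = 1 :=
    ae_prod_fst _ (ae_transpose_mul_mul_pinv hk2 hV)
  have hcomp : ∀ᵐ x ∂μ₁, ‖B - Y x * pinv (Vᵀ * matOf x.1) * Vᵀ‖ ≤ a₁ x.1 + c x := by
    filter_upwards [hF] with x hx using norm_sub_noisy_competitor_le M hV hBV _ hx
  have hIz : ∫⁻ x, ENNReal.ofReal (z x ^ 2) ∂μ₁.prod μ₂ ≤
      ENNReal.ofReal ((4 * ‖B - Bk‖ ^ 2 + 2 * (‖M‖ ^ 2 * κ) + ‖N‖ ^ 2) * ρ) := by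
    calc ∫⁻ x, ENNReal.ofReal (z x ^ 2) ∂μ₁.prod μ₂
        ≤ ∫⁻ x, ∫⁻ y, ENNReal.ofReal (z (x, y) ^ 2) ∂μ₂ ∂μ₁ := lintegral_prod_le _
      _ ≤ ∫⁻ x, ENNReal.ofReal ((‖B - Y x * pinv (Y x) * B‖ ^ 2 + ‖N‖ ^ 2) * ρ) ∂μ₁ :=
          lintegral_mono fun x => lintegral_coreError_sq_le (by omega) B N (Y x)
      _ ≤ ∫⁻ x, (2 * ENNReal.ofReal (a₁ x.1 ^ 2) + 2 * ENNReal.ofReal (c x ^ 2) +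
            ENNReal.ofReal (‖N‖ ^ 2)) * ENNReal.ofReal ρ ∂μ₁ := by
          refine lintegral_mono_ae ?_
          filter_upwards [hcomp] with x hx
          have h1 := (norm_sub_projection_le B (Y x) (pinv (Vᵀ * matOf x.1)) V).trans hx
          -- `(a + c)² ≤ 2 a² + 2 c²`
          have h2 : ‖B - Y x * pinv (Y x) * B‖ ^ 2 ≤ 2 * a₁ x.1 ^ 2 + 2 * c x ^ 2 := by
            nlinarith [mul_self_le_mul_self (norm_nonneg _) h1, sq_nonneg (a₁ x.1 - c x)]
          have h3 : (2 : ENNReal) = ENNReal.ofReal 2 := by simp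
          rw [h3, ← ENNReal.ofReal_mul (by norm_num), ← ENNReal.ofReal_mul (by norm_num),
            ← ENNReal.ofReal_add (by positivity) (by positivity),
            ← ENNReal.ofReal_add (by positivity) (by positivity),
            ← ENNReal.ofReal_mul (by positivity)]
          gcongr
      _ = (2 * ∫⁻ x, ENNReal.ofReal (a₁ x.1 ^ 2) ∂μ₁ + 2 * ∫⁻ x, ENNReal.ofReal (c x ^ 2) ∂μ₁ +
            ENNReal.ofReal (‖N‖ ^ 2)) * ENNReal.ofReal ρ := by
          rw [lintegral_mul_const' _ _ ENNReal.ofReal_ne_top, lintegral_add_right _ (by fun_prop),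
            lintegral_add_right _ (by fun_prop), lintegral_const_mul' _ _ (by simp),
            lintegral_const_mul' _ _ (by simp), lintegral_const, measure_univ, mul_one]
      _ ≤ (2 * ENNReal.ofReal ((1 + κ) * ‖B - Bk‖ ^ 2) + 2 * ENNReal.ofReal (‖M‖ ^ 2 * κ) +
            ENNReal.ofReal (‖N‖ ^ 2)) * ENNReal.ofReal ρ := by gcongr
      _ ≤ _ := by
          have h3 : (2 : ENNReal) = ENNReal.ofReal 2 := by simp
          rw [h3, ← ENNReal.ofReal_mul (by norm_num), ← ENNReal.ofReal_mul (by norm_num),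
            ← ENNReal.ofReal_add (by positivity) (by positivity),
            ← ENNReal.ofReal_add (by positivity) (by positivity),
            ← ENNReal.ofReal_mul (by positivity)]
          refine ENNReal.ofReal_le_ofReal (mul_le_mul_of_nonneg_right ?_ hρ0)
          -- `2 (1 + κ) ≤ 4`, as `κ ≤ 1`
          nlinarith [sq_nonneg ‖B - Bk‖]
  refine ⟨fun x => a₁ x.1.1, fun x => c x.1 + 2 * z x, by fun_prop, by fun_prop,
    fun x => ha0 _, fun x => by have := hz0 x; have := hc0 x.1; positivity, ?_, ?_, ?_⟩
  · exact (lintegral_prod_fst μ₁ μ₂ (f := fun y : (Fin m₂ × Fin sR → ℝ) × (Fin p × Fin sR → ℝ) =>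
      ENNReal.ofReal (a₁ y.1 ^ 2)) (by fun_prop)).le.trans hIa
  · calc ∫⁻ x, ENNReal.ofReal ((c x.1 + 2 * z x) ^ 2) ∂μ₁.prod μ₂
        ≤ ∫⁻ x, (2 * ENNReal.ofReal (c x.1 ^ 2) + 8 * ENNReal.ofReal (z x ^ 2)) ∂μ₁.prod μ₂ := by
          refine lintegral_mono fun x => ?_
          have h3 : (2 : ENNReal) = ENNReal.ofReal 2 := by simp
          have h4 : (8 : ENNReal) = ENNReal.ofReal 8 := by simp
          rw [h3, h4, ← ENNReal.ofReal_mul (by norm_num), ← ENNReal.ofReal_mul (by norm_num),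
            ← ENNReal.ofReal_add (by positivity) (by positivity)]
          refine ENNReal.ofReal_le_ofReal ?_
          nlinarith [sq_nonneg (c x.1 - 2 * z x)]
      _ = 2 * ∫⁻ x, ENNReal.ofReal (c x ^ 2) ∂μ₁ +
            8 * ∫⁻ x, ENNReal.ofReal (z x ^ 2) ∂μ₁.prod μ₂ := by
          rw [lintegral_add_right _ (by fun_prop), lintegral_const_mul' _ _ (by simp),
            lintegral_const_mul' _ _ (by simp),
            lintegral_prod_fst _ _ (f := fun x => ENNReal.ofReal (c x ^ 2)) (by fun_prop)]
      _ ≤ 2 * ENNReal.ofReal (‖M‖ ^ 2 * κ) + 8 * ENNReal.ofReal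
            ((4 * ‖B - Bk‖ ^ 2 + 2 * (‖M‖ ^ 2 * κ) + ‖N‖ ^ 2) * ρ) := by gcongr
      _ ≤ _ := by
          have h3 : (2 : ENNReal) = ENNReal.ofReal 2 := by simp
          have h4 : (8 : ENNReal) = ENNReal.ofReal 8 := by simp
          rw [h3, h4, ← ENNReal.ofReal_mul (by norm_num), ← ENNReal.ofReal_mul (by norm_num),
            ← ENNReal.ofReal_add (by positivity) (by positivity)]
          refine ENNReal.ofReal_le_ofReal ?_
          rw [mul_div_assoc, mul_div_assoc, mul_div_assoc, ← hκ, ← hρ]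
          -- with `ρ ≤ 1` the coefficient of `‖M‖² κ` is `2 + 8 · 2 ρ ≤ 18`
          have : ‖M‖ ^ 2 * κ * ρ ≤ ‖M‖ ^ 2 * κ := mul_le_of_le_one_right (by positivity) hρ1
          nlinarith
  · have hPsi : ∀ᵐ x ∂μ₁.prod μ₂,
        pinv ((matOf x.2.1)ᵀ * (Y x.1 * pinv (Y x.1))) *
          ((matOf x.2.1)ᵀ * (Y x.1 * pinv (Y x.1))) = Y x.1 * pinv (Y x.1) := by
      refine (Measure.ae_prod_iff_ae_ae ?_).2 (ae_of_all _ fun x =>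
        ae_prod_fst _ (ae_pinv_transpose_mul_projection (by omega) (Y x)))
      simp_rw [← sub_eq_zero (b := Y _ * pinv (Y _))]
      exact (measurableSet_singleton (0 : Matrix (Fin m₁) (Fin m₁) ℝ)).preimage (by fun_prop)
    filter_upwards [hPsi, ae_prod_fst μ₂ hcomp] with x hx hx' Q hQ T hT
    have := hQ.norm_sub_mul_truncated_le hx hT hk' (pinv (Vᵀ * matOf x.1.1)) hV
    linarith

/-- The triangle inequality in `L²`, in squared form. -/
theorem integrable_sq_and_integral_sq_le {S : Type*} [MeasurableSpace S] {μ : Measure S}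
    {f a b : S → ℝ} (hf : AEMeasurable f μ) (ha : AEMeasurable a μ) (hb : AEMeasurable b μ)
    (hf0 : ∀ x, 0 ≤ f x) (ha0 : ∀ x, 0 ≤ a x) (hb0 : ∀ x, 0 ≤ b x)
    (hfab : ∀ᵐ x ∂μ, f x ≤ a x + b x) {E₁ E₂ : ℝ} (hE₁ : 0 ≤ E₁) (hE₂ : 0 ≤ E₂)
    (hIa : ∫⁻ x, ENNReal.ofReal (a x ^ 2) ∂μ ≤ ENNReal.ofReal E₁)
    (hIb : ∫⁻ x, ENNReal.ofReal (b x ^ 2) ∂μ ≤ ENNReal.ofReal E₂) :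
    Integrable (fun x => f x ^ 2) μ ∧ ∫ x, f x ^ 2 ∂μ ≤ E₁ + E₂ + 2 * √(E₁ * E₂) := by
  have hsq : ∀ {t : ℝ}, 0 ≤ t → ENNReal.ofReal t ^ (2 : ℝ) = ENNReal.ofReal (t ^ 2) := by
    intro t ht
    rw [ENNReal.ofReal_rpow_of_nonneg ht (by norm_num), Real.rpow_two]
  have hroot : ∀ {E : ℝ}, 0 ≤ E → ENNReal.ofReal E ^ (1 / 2 : ℝ) = ENNReal.ofReal √E := by
    intro E hE
    rw [ENNReal.ofReal_rpow_of_nonneg hE (by norm_num), Real.sqrt_eq_rpow]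
  have hmink := ENNReal.lintegral_Lp_add_le ha.ennreal_ofReal hb.ennreal_ofReal
    (one_le_two : (1 : ℝ) ≤ 2)
  simp only [Pi.add_apply, hsq (ha0 _), hsq (hb0 _)] at hmink
  have hI : ∫⁻ x, ENNReal.ofReal (f x ^ 2) ∂μ ≤
      ENNReal.ofReal (E₁ + E₂ + 2 * √(E₁ * E₂)) := by
    calc ∫⁻ x, ENNReal.ofReal (f x ^ 2) ∂μ
        ≤ ∫⁻ x, (ENNReal.ofReal (a x) + ENNReal.ofReal (b x)) ^ (2 : ℝ) ∂μ := by
          refine lintegral_mono_ae ?_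
          filter_upwards [hfab] with x hx
          rw [← ENNReal.ofReal_add (ha0 x) (hb0 x), hsq (add_nonneg (ha0 x) (hb0 x))]
          have := hf0 x
          gcongr
      _ ≤ (ENNReal.ofReal √E₁ + ENNReal.ofReal √E₂) ^ (2 : ℝ) := by
          rw [← hroot hE₁, ← hroot hE₂]
          have h := ENNReal.rpow_le_rpow (z := 2) (hmink.trans (add_le_add
            (ENNReal.rpow_le_rpow hIa (by norm_num)) (ENNReal.rpow_le_rpow hIb (by norm_num))))
            (by norm_num)
          rwa [← ENNReal.rpow_mul, one_div, inv_mul_cancel₀ two_ne_zero, ENNReal.rpow_one,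
            ← one_div] at h
      _ = ENNReal.ofReal (E₁ + E₂ + 2 * √(E₁ * E₂)) := by
          rw [← ENNReal.ofReal_add (by positivity) (by positivity), hsq (by positivity)]
          congr 1
          rw [add_sq, Real.sq_sqrt hE₁, Real.sq_sqrt hE₂, Real.sqrt_mul hE₁]
          ring
  have hint : Integrable (fun x => f x ^ 2) μ := by
    refine ⟨(hf.pow_const 2).aestronglyMeasurable, ?_⟩
    rw [hasFiniteIntegral_iff_ofReal (ae_of_all _ fun x => sq_nonneg _)]
    exact hI.trans_lt ENNReal.ofReal_lt_top
  refine ⟨hint, ?_⟩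
  rw [integral_eq_lintegral_of_nonneg_ae (ae_of_all _ fun x => sq_nonneg _)
    hint.aestronglyMeasurable]
  exact ENNReal.toReal_le_of_le_ofReal (by positivity) hI

/-! ### Laws of the sketches -/

theorem IsGaussianMatrix.aemeasurable {S : Type*} [MeasurableSpace S] {μ : Measure S} {p q : ℕ}
    {G : S → Matrix (Fin p) (Fin q) ℝ} (hG : IsGaussianMatrix μ G) :
    AEMeasurable (fun ω i j => G ω i j) μ :=
  aemeasurable_pi_lambda _ fun i => aemeasurable_pi_lambda _ fun j => (hG.hasLaw i j).aemeasurable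

theorem IsGaussianMatrix.map_eq {S : Type*} [MeasurableSpace S] {μ : Measure S}
    [IsProbabilityMeasure μ] {p q : ℕ} {G : S → Matrix (Fin p) (Fin q) ℝ}
    (hG : IsGaussianMatrix μ G) :
    μ.map (fun ω (ij : Fin p × Fin q) => G ω ij.1 ij.2) = stdNormal (Fin p × Fin q) := by
  refine ((iIndepFun_iff_map_fun_eq_pi_map
    fun ij : Fin p × Fin q => (hG.hasLaw ij.1 ij.2).aemeasurable).1 hG.indep).trans ?_
  congr 1
  funext ij
  exact (hG.hasLaw ij.1 ij.2).map_eq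

/-- The joint law of four independent standard normal matrices. The matrices are only almost
everywhere measurable, so that the σ-algebras in `h` need not consist of measurable sets; the
independence is therefore rephrased in terms of random variables. -/
theorem map_sketches_eq {S : Type*} [MeasurableSpace S] {μ : Measure S} [IsProbabilityMeasure μ]
    {p₁ q₁ p₂ q₂ p₃ q₃ p₄ q₄ : ℕ} {G₁ : S → Matrix (Fin p₁) (Fin q₁) ℝ}
    {G₂ : S → Matrix (Fin p₂) (Fin q₂) ℝ} {G₃ : S → Matrix (Fin p₃) (Fin q₃) ℝ}
    {G₄ : S → Matrix (Fin p₄) (Fin q₄) ℝ} (h₁ : IsGaussianMatrix μ G₁)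
    (h₂ : IsGaussianMatrix μ G₂) (h₃ : IsGaussianMatrix μ G₃) (h₄ : IsGaussianMatrix μ G₄)
    (h : iIndep ![sigmaOf G₁, sigmaOf G₂, sigmaOf G₃, sigmaOf G₄] μ) :
    AEMeasurable (fun ω => (((fun ij : Fin p₁ × Fin q₁ => G₁ ω ij.1 ij.2),
      (fun ij : Fin p₂ × Fin q₂ => G₂ ω ij.1 ij.2)),
      ((fun ij : Fin p₃ × Fin q₃ => G₃ ω ij.1 ij.2),
      (fun ij : Fin p₄ × Fin q₄ => G₄ ω ij.1 ij.2)))) μ ∧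
    μ.map (fun ω => (((fun ij : Fin p₁ × Fin q₁ => G₁ ω ij.1 ij.2),
      (fun ij : Fin p₂ × Fin q₂ => G₂ ω ij.1 ij.2)),
      ((fun ij : Fin p₃ × Fin q₃ => G₃ ω ij.1 ij.2),
      (fun ij : Fin p₄ × Fin q₄ => G₄ ω ij.1 ij.2)))) =
    ((stdNormal (Fin p₁ × Fin q₁)).prod (stdNormal (Fin p₂ × Fin q₂))).prod
      ((stdNormal (Fin p₃ × Fin q₃)).prod (stdNormal (Fin p₄ × Fin q₄))) := by
  let β : Fin 4 → Type := fun i =>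
    Fin (![p₁, p₂, p₃, p₄] i) → Fin (![q₁, q₂, q₃, q₄] i) → ℝ
  let f : ∀ i : Fin 4, S → β i := fun i => match i with
    | 0 => fun ω i j => G₁ ω i j
    | 1 => fun ω i j => G₂ ω i j
    | 2 => fun ω i j => G₃ ω i j
    | 3 => fun ω i j => G₄ ω i j
  have hind : iIndepFun f μ := by
    have : (fun i => MeasurableSpace.comap (f i) MeasurableSpace.pi) =
        ![sigmaOf G₁, sigmaOf G₂, sigmaOf G₃, sigmaOf G₄] := by
      funext i
      fin_cases i <;> rfl
    rw [iIndepFun_iff_iIndep]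
    exact this ▸ h
  have hfm : ∀ i, AEMeasurable (f i) μ := by
    intro i
    fin_cases i
    · exact h₁.aemeasurable
    · exact h₂.aemeasurable
    · exact h₃.aemeasurable
    · exact h₄.aemeasurable
  have hunc : ∀ m n : ℕ, Measurable fun (x : Fin m → Fin n → ℝ) (ij : Fin m × Fin n) =>
      x ij.1 ij.2 := fun m n => by fun_prop
  have hm₁ := (hunc _ _).comp_aemeasurable h₁.aemeasurable
  have hm₂ := (hunc _ _).comp_aemeasurable h₂.aemeasurable
  have hm₃ := (hunc _ _).comp_aemeasurable h₃.aemeasurable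
  have hm₄ := (hunc _ _).comp_aemeasurable h₄.aemeasurable
  have h12 := (hind.indepFun (i := 0) (j := 1) (by decide)).comp (hunc p₁ q₁) (hunc p₂ q₂)
  have h34 := (hind.indepFun (i := 2) (j := 3) (by decide)).comp (hunc p₃ q₃) (hunc p₄ q₄)
  have h1234 := (hind.indepFun_prodMk_prodMk₀ hfm 0 1 2 3 (by decide) (by decide) (by decide)
    (by decide)).comp ((hunc p₁ q₁).prodMap (hunc p₂ q₂)) ((hunc p₃ q₃).prodMap (hunc p₄ q₄))
  refine ⟨(hm₁.prodMk hm₂).prodMk (hm₃.prodMk hm₄), ?_⟩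
  refine ((indepFun_iff_map_prod_eq_prod_map_map (hm₁.prodMk hm₂) (hm₃.prodMk hm₄)).1
    h1234).trans ?_
  rw [← h₁.map_eq, ← h₂.map_eq, ← h₃.map_eq, ← h₄.map_eq]
  exact congrArg₂ Measure.prod ((indepFun_iff_map_prod_eq_prod_map_map hm₁ hm₂).1 h12)
    ((indepFun_iff_map_prod_eq_prod_map_map hm₃ hm₄).1 h34)

/-! ### The expected error of the sketched low-rank approximation -/

theorem mainTheorem4 {S : Type*} [MeasurableSpace S] (μ : Measure S) [IsProbabilityMeasure μ]
    (m₁ m₂ p q k sR sL : ℕ)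
    (hsR : 2 * k + 1 < sR) (hsL : 2 * sR + 1 < sL)
    (B : Matrix (Fin m₁) (Fin m₂) ℝ)
    (M : Matrix (Fin m₁) (Fin p) ℝ)
    (N : Matrix (Fin q) (Fin m₂) ℝ)
    -- the Gaussian sketches, jointly independent
    (Om : S → Matrix (Fin m₂) (Fin sR) ℝ) (hOm : IsGaussianMatrix μ Om)
    (Om' : S → Matrix (Fin p) (Fin sR) ℝ) (hOm' : IsGaussianMatrix μ Om')
    (Psi : S → Matrix (Fin m₁) (Fin sL) ℝ) (hPsi : IsGaussianMatrix μ Psi)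
    (Psi' : S → Matrix (Fin q) (Fin sL) ℝ) (hPsi' : IsGaussianMatrix μ Psi')
    (hindep : iIndep ![sigmaOf Om, sigmaOf Om', sigmaOf Psi, sigmaOf Psi'] μ)
    -- `Q = orth(B Ω + M Ω')`
    (Q : ∀ ω, Matrix (Fin m₁) (Fin (B * Om ω + M * Om' ω).rank) ℝ)
    (hQ : ∀ ω, IsOrth (B * Om ω + M * Om' ω) (Q ω))
    -- `X = (Ψᵀ Q)† (Ψᵀ B + Ψ'ᵀ N)`
    (X : ∀ ω, Matrix (Fin (B * Om ω + M * Om' ω).rank) (Fin m₂) ℝ)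
    (hX : ∀ ω, X ω = pinv ((Psi ω)ᵀ * Q ω) * ((Psi ω)ᵀ * B + (Psi' ω)ᵀ * N))
    -- `Xk = ⟦X⟧ₖ` and `Bk = ⟦B⟧ₖ`
    (Xk : ∀ ω, Matrix (Fin (B * Om ω + M * Om' ω).rank) (Fin m₂) ℝ)
    (hXk : ∀ ω, IsTruncatedSVD k (X ω) (Xk ω))
    (Bk : Matrix (Fin m₁) (Fin m₂) ℝ) (hBk : IsTruncatedSVD k B Bk)
    -- the (possibly non-unique) bases and truncations are chosen so that the error is a
    -- random variable
    (hmeas : AEMeasurable (fun ω => ‖B - Q ω * Xk ω‖) μ)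
    (E₁ E₂ : ℝ)
    (hE₁ : E₁ = (1 + (k : ℝ) / ((sR : ℝ) - k - 1)) * ‖B - Bk‖ ^ 2)
    (hE₂ : E₂ = 18 * (k : ℝ) / ((sR : ℝ) - k - 1) * ‖M‖ ^ 2
      + 8 * (sR : ℝ) / ((sL : ℝ) - sR - 1) * ‖N‖ ^ 2
      + 32 * (sR : ℝ) / ((sL : ℝ) - sR - 1) * ‖B - Bk‖ ^ 2) :
    Integrable (fun ω => ‖B - Q ω * Xk ω‖ ^ 2) μ ∧
      ∫ ω, ‖B - Q ω * Xk ω‖ ^ 2 ∂μ ≤ E₁ + E₂ + 2 * √(E₁ * E₂) := by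
  obtain ⟨a, b, ham, hbm, ha0, hb0, hIa, hIb, hae⟩ := exists_error_bounds hsR hsL B M N hBk
  obtain ⟨hGm, hG⟩ := map_sketches_eq hOm hOm' hPsi hPsi' hindep
  set G : S → ((Fin m₂ × Fin sR → ℝ) × (Fin p × Fin sR → ℝ)) ×
      ((Fin m₁ × Fin sL → ℝ) × (Fin q × Fin sL → ℝ)) := fun ω =>
    (((fun ij => Om ω ij.1 ij.2), (fun ij => Om' ω ij.1 ij.2)),
      ((fun ij => Psi ω ij.1 ij.2), (fun ij => Psi' ω ij.1 ij.2))) with hGdef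
  rw [← hG] at hIa hIb hae
  rw [lintegral_map' (by fun_prop) hGm, ← hE₁] at hIa
  rw [lintegral_map' (by fun_prop) hGm, ← hE₂] at hIb
  have hsR' : 2 * (k : ℝ) + 2 ≤ sR := by exact_mod_cast hsR
  have hsL' : 2 * (sR : ℝ) + 2 ≤ sL := by exact_mod_cast hsL
  have hk0 : (0 : ℝ) ≤ k := Nat.cast_nonneg k
  have hdR : 0 < (sR : ℝ) - k - 1 := by linarith
  have hdL : 0 < (sL : ℝ) - sR - 1 := by linarith
  refine integrable_sq_and_integral_sq_le hmeas (ham.comp_aemeasurable hGm)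
    (hbm.comp_aemeasurable hGm) (fun ω => norm_nonneg _) (fun ω => ha0 _) (fun ω => hb0 _) ?_
    (by rw [hE₁]; positivity) (by rw [hE₂]; positivity) hIa hIb
  filter_upwards [ae_of_ae_map hGm hae] with ω hω
  refine hω (Q ω) (hQ ω) (Xk ω) ?_
  have h := hXk ω
  rw [hX ω] at h
  exact h
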